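/- **Theorem 1.** Let $a,b>0$. Let $\mathcal{E}^*_{\mathrm{1LR}}$ be the infimum, over all integers $k\ge 1$, all real positive semidefinite $k\times k$ matrices $\Sigma$ of rank $1$, and all strictly lower triangular real $k\times k$ matrices $D$, of $$\frac{\operatorname{tr}(\Sigma+a^2D\Sigma D^T+DD^T)}{\frac12\log_2\frac{\det((I+abD)\Sigma(I+abD^T)+I+b^2DD^T)}{\det(I+b^2DD^T)}}.$$ For $A_f,B_f>0$ put $$\phi=A_fB_f+\frac1{A_f}-\frac1{B_f},\qquad f(w)=\frac{\phi w-1+\sqrt{(\phi w-1)^2+4w^3}}{2w^2}.$$ If $A_f,B_f>0$ and $A_f/B_f\le a^2$, then there is a unique pair $(A_0,\psi)$ with $A_0\ge A_f$, $\psi>0$ and $$\int_{A_f}^{A_0}\frac{f(w)\,dw}{1+wf(w)^2}=\frac{A_0}{a\psi}-\frac1{B_f},\qquad \int_{A_f}^{A_0}\frac{f(w)^2\,dw}{1+wf(w)^2}=\ln\left(\frac{A_0^3B_f}{a^4\psi^2}\right).$$ With this pair, let $B_0=f(A_0)$, $$Q_1=-\frac1{a^2}+\frac{A_0^3B_f}{a^6\psi^2},\qquad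 Q_2=-\frac1{b^2}+\frac{A_0^3}{a^5b^2\psi^3}+\frac{A_0^2(A_fB_f^2-1)}{a^4b^2\psi^2B_f},$$ and, for $A_f/B_f<a^2$ (when $A_f/B_f=a^2$ the quotient below has the form $0/0$), let $$\mathcal{E}(A_f,B_f)=\frac{Q_1+Q_2}{\frac12\log_2\left(\frac{A_0}{a^2}\left(\frac1{B_f}+A_0B_0-A_fB_f\right)\right)}.$$ Then $$\mathcal{E}^*_{\mathrm{1LR}}\le\inf_{A_f,B_f>0,\ A_f/B_f<a^2}\mathcal{E}(A_f,B_f).$$ -/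

import Mathlib

namespace GaussianRelay

open Matrix

/-- A `k × k` matrix is strictly lower triangular. -/
def StrictlyLower {k : ℕ} (D : Matrix (Fin k) (Fin k) ℝ) : Prop :=
  ∀ i j : Fin k, i ≤ j → D i j = 0

/-- Energy-per-bit of the linear relay code with transmit covariance `C` and relaying matrix `D`
on the Gaussian relay channel with gains `a`, `b`.  (For `C` positive semidefinite of rank one and
`D` strictly lower triangular, the argument of the logarithm exceeds one.) -/
noncomputable def linearEnergyPerBit (a b : ℝ) {k : ℕ} (C D : Matrix (Fin k) (Fin k) ℝ) : ℝ :=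
  (C + a ^ 2 • (D * C * Dᵀ) + D * Dᵀ).trace /
    ((1 / 2) * Real.logb 2
      (((1 + (a * b) • D) * C * (1 + (a * b) • Dᵀ) + 1 + b ^ 2 • (D * Dᵀ)).det /
        (1 + b ^ 2 • (D * Dᵀ)).det))

/-- The infimum of the energy-per-bit over all block lengths `k ≥ 1`, all positive semidefinite
transmit covariances of rank one, and all strictly lower triangular relaying matrices. -/
noncomputable def minEnergyRankOne (a b : ℝ) : EReal :=
  sInf {E : EReal | ∃ k : ℕ, 0 < k ∧ ∃ C D : Matrix (Fin k) (Fin k) ℝ,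
    C.PosSemidef ∧ C.rank = 1 ∧ StrictlyLower D ∧ E = ((linearEnergyPerBit a b C D : ℝ) : EReal)}

noncomputable def phi (Af Bf : ℝ) : ℝ := Af * Bf + 1 / Af - 1 / Bf

/-- The function `f`; it depends on `Af`, `Bf` through `phi`. -/
noncomputable def f (Af Bf w : ℝ) : ℝ :=
  (phi Af Bf * w - 1 + Real.sqrt ((phi Af Bf * w - 1) ^ 2 + 4 * w ^ 3)) / (2 * w ^ 2)

/-- The conditions that determine the pair `(A₀, ψ)`. On `[Af, A₀]` with `0 < Af` the integrands
are continuous, so both interval integrals are genuine. -/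
def IsPair (a Af Bf A₀ ψ : ℝ) : Prop :=
  Af ≤ A₀ ∧ 0 < ψ ∧
    (∫ w in Af..A₀, f Af Bf w / (1 + w * f Af Bf w ^ 2)) = A₀ / (a * ψ) - 1 / Bf ∧
    (∫ w in Af..A₀, f Af Bf w ^ 2 / (1 + w * f Af Bf w ^ 2)) =
      Real.log (A₀ ^ 3 * Bf / (a ^ 4 * ψ ^ 2))

/-- The pair `(A₀, ψ)`; its existence and uniqueness are part of the theorem. -/
noncomputable def pair (a Af Bf : ℝ) : ℝ × ℝ :=
  Classical.epsilon fun p : ℝ × ℝ => IsPair a Af Bf p.1 p.2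

noncomputable def Q₁ (a Bf A₀ ψ : ℝ) : ℝ :=
  -(1 / a ^ 2) + A₀ ^ 3 * Bf / (a ^ 6 * ψ ^ 2)

noncomputable def Q₂ (a b Af Bf A₀ ψ : ℝ) : ℝ :=
  -(1 / b ^ 2) + A₀ ^ 3 / (a ^ 5 * b ^ 2 * ψ ^ 3) +
    A₀ ^ 2 * (Af * Bf ^ 2 - 1) / (a ^ 4 * b ^ 2 * ψ ^ 2 * Bf)

/-- The quantity `𝓔(Af, Bf)`. -/
noncomputable def energyBound (a b Af Bf : ℝ) : ℝ :=
  let A₀ := (pair a Af Bf).1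
  let ψ := (pair a Af Bf).2
  let B₀ := f Af Bf A₀
  (Q₁ a Bf A₀ ψ + Q₂ a b Af Bf A₀ ψ) /
    ((1 / 2) * Real.logb 2 (A₀ / a ^ 2 * (1 / Bf + A₀ * B₀ - Af * Bf)))

end GaussianRelay

/-! The bound is proved by exhibiting codes. For a rank-one covariance `vecMulVec x x` and relaying
matrix `b⁻¹ • D`, the determinant ratio is `1 + yᵀ(1 + D Dᵀ)⁻¹y` with `y = x + a D x`, and any fixed
linear receiver `h` bounds it below (`minEnergyRankOne_le`). The vectors and the matrix are then
sampled from functions and a kernel on `[p, q]`. As the mesh tends to zero all energies converge to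
integrals, so every continuous-time code bounds the infimum (`minEnergyRankOne_le_of_kernel`).

It remains to choose a good continuous code on `[Af, A₀]`, with time running from `A₀` down. Write
`I₁`, `I₂` for the two integrands of the pair conditions, `T` for the integral of `I₁` over `[w,
A₀]` and `S` for the exponential of that of `I₂`. The function `f` satisfies an ODE, and together
with `I₁ = I₂ / f` and `1 - w I₂ = I₂ / f²` it gives every energy an explicit antiderivative. The
pair conditions prescribe `T` and `S` at `Af`. Inserting these values turns the energies into `Q₁`
and `b² Q₂`, and makes the receiver's gain and noise power equal, which produces the argument of the
logarithm (`minEnergyRankOne_le_energyBound`).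

Existence and uniqueness of the pair are a separate matter: `ψ` is eliminated, and the remaining
function of `A₀` increases at least as fast as a multiple of `log`. -/

namespace GaussianRelay

/-! ### The function `f` and the existence and uniqueness of the pair. -/

section Pair

lemma f_radicand_pos (Af Bf : ℝ) {w : ℝ} (hw : 0 < w) :
    0 < (phi Af Bf * w - 1) ^ 2 + 4 * w ^ 3 := by positivity

lemma f_pos (Af Bf : ℝ) {w : ℝ} (hw : 0 < w) : 0 < f Af Bf w := by
  unfold f
  have h : |phi Af Bf * w - 1| < √((phi Af Bf * w - 1) ^ 2 + 4 * w ^ 3) := by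
    rw [← Real.sqrt_sq_eq_abs]
    exact Real.sqrt_lt_sqrt (sq_nonneg _) (by have : 0 < w ^ 3 := by positivity
                                              linarith)
  have := neg_abs_le (phi Af Bf * w - 1)
  exact div_pos (by linarith) (by positivity)

/-- `f` is the positive root of this quadratic. The growth bound and the value of the derivative
come from here rather than from the closed form. -/
lemma f_quadratic (Af Bf : ℝ) {w : ℝ} (hw : 0 < w) :
    w ^ 2 * f Af Bf w ^ 2 + f Af Bf w = phi Af Bf * w * f Af Bf w + w := by
  have hs := Real.sq_sqrt (f_radicand_pos Af Bf hw).le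
  unfold f
  set s := √((phi Af Bf * w - 1) ^ 2 + 4 * w ^ 3)
  field_simp
  linear_combination hs

/-- `phi` is chosen for this: it makes the radicand a perfect square at `w = Af`. -/
lemma f_left {Af Bf : ℝ} (hA : 0 < Af) (hB : 0 < Bf) : f Af Bf Af = Bf := by
  have h : (phi Af Bf * Af - 1) ^ 2 + 4 * Af ^ 3 = (Af ^ 2 * Bf + Af / Bf) ^ 2 := by
    unfold phi; field_simp; ring
  unfold f
  rw [h, Real.sqrt_sq (by positivity)]
  unfold phi; field_simp; ring

/-- Implicit differentiation of the quadratic. Eliminating `phi` leaves an ODE in `w` and `f` alone,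
the source of all antiderivatives below. -/
lemma hasDerivAt_f (Af Bf : ℝ) {w : ℝ} (hw : 0 < w) :
    HasDerivAt (f Af Bf)
      ((1 / w ^ 2 - f Af Bf w) * f Af Bf w ^ 2 / (1 + w * f Af Bf w ^ 2)) w := by
  have hd : DifferentiableAt ℝ (f Af Bf) w := by
    unfold f
    have := (f_radicand_pos Af Bf hw).ne'
    have h2 : 2 * w ^ 2 ≠ 0 := by positivity
    fun_prop (disch := assumption)
  have h := hd.hasDerivAt
  have hpos := f_pos Af Bf hw
  have hl : HasDerivAt (fun v => v ^ 2 * f Af Bf v ^ 2 + f Af Bf v)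
      (2 * w * f Af Bf w ^ 2 + w ^ 2 * (2 * f Af Bf w * deriv (f Af Bf) w)
        + deriv (f Af Bf) w) w := by
    refine ((((hasDerivAt_id w).pow 2).mul (h.pow 2)).add h).congr_deriv ?_
    simp
  have hr : HasDerivAt (fun v => phi Af Bf * v * f Af Bf v + v)
      (phi Af Bf * f Af Bf w + phi Af Bf * w * deriv (f Af Bf) w + 1) w := by
    refine ((((hasDerivAt_id w).const_mul (phi Af Bf)).mul h).add (hasDerivAt_id w)).congr_deriv ?_
    simp
  have heq := (hr.congr_of_eventuallyEq ((eventually_gt_nhds hw).mono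
    fun v hv => f_quadratic Af Bf hv)).unique hl
  have hq := f_quadratic Af Bf hw
  refine h.congr_deriv ?_
  set d := deriv (f Af Bf) w
  set y := f Af Bf w
  rw [eq_div_iff (by positivity)]
  have hphi : phi Af Bf = (w ^ 2 * y ^ 2 + y - w) / (w * y) := by
    field_simp; linarith
  rw [hphi] at heq
  field_simp at heq ⊢
  linear_combination -heq

lemma continuousOn_f (Af Bf : ℝ) : ContinuousOn (f Af Bf) (Set.Ioi 0) :=
  fun _ hw => (hasDerivAt_f Af Bf hw).continuousAt.continuousWithinAt

/-- The integrand of the first condition on the pair. -/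
noncomputable def firstIntegrand (Af Bf w : ℝ) : ℝ := f Af Bf w / (1 + w * f Af Bf w ^ 2)

/-- The integrand of the second condition on the pair. -/
noncomputable def secondIntegrand (Af Bf w : ℝ) : ℝ := f Af Bf w ^ 2 / (1 + w * f Af Bf w ^ 2)

lemma continuousOn_firstIntegrand (Af Bf : ℝ) :
    ContinuousOn (firstIntegrand Af Bf) (Set.Ioi 0) := by
  have := continuousOn_f Af Bf
  refine this.div (by fun_prop) fun w (hw : 0 < w) => by positivity

lemma continuousOn_secondIntegrand (Af Bf : ℝ) :
    ContinuousOn (secondIntegrand Af Bf) (Set.Ioi 0) := by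
  have := continuousOn_f Af Bf
  refine (this.pow 2).div (by fun_prop) fun w (hw : 0 < w) => by positivity

lemma uIcc_subset_Ioi {p q : ℝ} (hp : 0 < p) (hq : 0 < q) : Set.uIcc p q ⊆ Set.Ioi 0 :=
  fun _ hx => (lt_min hp hq).trans_le hx.1

lemma intervalIntegrable_of_continuousOn_Ioi {g : ℝ → ℝ} (hg : ContinuousOn g (Set.Ioi 0))
    {p q : ℝ} (hp : 0 < p) (hq : 0 < q) : IntervalIntegrable g MeasureTheory.volume p q :=
  (hg.mono (uIcc_subset_Ioi hp hq)).intervalIntegrable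

lemma hasDerivAt_integral_right {g : ℝ → ℝ} (hg : ContinuousOn g (Set.Ioi 0))
    {p w : ℝ} (hp : 0 < p) (hw : 0 < w) : HasDerivAt (fun v => ∫ u in p..v, g u) (g w) w :=
  intervalIntegral.integral_hasDerivAt_right (intervalIntegrable_of_continuousOn_Ioi hg hp hw)
    (hg.stronglyMeasurableAtFilter isOpen_Ioi w hw) (hg.continuousAt (Ioi_mem_nhds hw))

lemma hasDerivAt_integral_left {g : ℝ → ℝ} (hg : ContinuousOn g (Set.Ioi 0))
    {q w : ℝ} (hq : 0 < q) (hw : 0 < w) : HasDerivAt (fun v => ∫ u in v..q, g u) (-g w) w :=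
  intervalIntegral.integral_hasDerivAt_left (intervalIntegrable_of_continuousOn_Ioi hg hw hq)
    (hg.stronglyMeasurableAtFilter isOpen_Ioi w hw) (hg.continuousAt (Ioi_mem_nhds hw))

/-- `w f(w)²` is bounded on `[Af, ∞)`. -/
lemma mul_f_sq_le {Af Bf w : ℝ} (hA : 0 < Af) (hw : Af ≤ w) :
    w * f Af Bf w ^ 2 ≤ (|phi Af Bf| / √Af + 1) ^ 2 := by
  have hw0 : 0 < w := hA.trans_le hw
  have hq := f_quadratic Af Bf hw0
  have hp := f_pos Af Bf hw0
  set y := f Af Bf w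
  set t := √w
  set m := |phi Af Bf| / √Af with hm
  have ht : 0 < t := Real.sqrt_pos.2 hw0
  have htt : t ^ 2 = w := Real.sq_sqrt hw0.le
  have hm0 : 0 ≤ m := by positivity
  have hphi : phi Af Bf ≤ m * t := by
    have h1 : √Af ≤ t := Real.sqrt_le_sqrt hw
    have h2 : 0 < √Af := Real.sqrt_pos.2 hA
    calc phi Af Bf ≤ |phi Af Bf| := le_abs_self _
      _ = m * √Af := by rw [hm]; field_simp
      _ ≤ m * t := by gcongr
  -- The quadratic divided by `w`, without its positive term `y`, in the variable `√w · f`.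
  have hz : (t * y) ^ 2 ≤ m * (t * y) + 1 := by
    have h1 : w * (t * y) ^ 2 ≤ w * (m * (t * y) + 1) := by
      have h2 : phi Af Bf * w * y ≤ m * t * w * y := by gcongr
      calc w * (t * y) ^ 2 = w ^ 2 * y ^ 2 := by rw [← htt]; ring
        _ ≤ phi Af Bf * w * y + w := by linarith
        _ ≤ m * t * w * y + w := by linarith
        _ = _ := by ring
    exact le_of_mul_le_mul_left h1 hw0
  have hle : t * y ≤ m + 1 := by
    by_contra! hc
    nlinarith
  calc w * y ^ 2 = (t * y) ^ 2 := by rw [← htt]; ring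
    _ ≤ _ := by gcongr

/-- The function of `A₀` whose zero determines the pair, once `ψ` has been eliminated. -/
noncomputable def pairFun (a Af Bf A : ℝ) : ℝ :=
  Real.log A + 2 * Real.log (1 / Bf + ∫ w in Af..A, firstIntegrand Af Bf w)
    + Real.log (Bf / a ^ 2) - ∫ w in Af..A, secondIntegrand Af Bf w

lemma first_integral_nonneg {Af Bf A : ℝ} (hA : 0 < Af) (h : Af ≤ A) :
    0 ≤ ∫ w in Af..A, firstIntegrand Af Bf w :=
  intervalIntegral.integral_nonneg h fun w hw => by
    have hw0 := hA.trans_le hw.1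
    have := f_pos Af Bf hw0
    unfold firstIntegrand; positivity

/-- Subtracting `κ log A` quantifies the growth: it gives strict monotonicity, and unboundedness
because `log` is unbounded. -/
lemma pairFun_slope {a Af Bf : ℝ} (hA : 0 < Af) (hB : 0 < Bf) :
    ∃ κ > 0, MonotoneOn (fun A => pairFun a Af Bf A - κ * Real.log A) (Set.Ici Af) ∧
      ContinuousOn (pairFun a Af Bf) (Set.Ici Af) := by
  set m := (|phi Af Bf| / √Af + 1) ^ 2
  have hm : 0 ≤ m := by positivity
  have hder : ∀ A ∈ Set.Ici Af, HasDerivAt (pairFun a Af Bf)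
      (1 / A + 2 * (firstIntegrand Af Bf A / (1 / Bf + ∫ w in Af..A, firstIntegrand Af Bf w))
        - secondIntegrand Af Bf A) A := by
    intro A hAA
    have hA0 : 0 < A := hA.trans_le hAA
    have h1 := hasDerivAt_integral_right (continuousOn_firstIntegrand Af Bf) hA hA0
    have h2 := hasDerivAt_integral_right (continuousOn_secondIntegrand Af Bf) hA hA0
    have hpos : 1 / Bf + ∫ w in Af..A, firstIntegrand Af Bf w ≠ 0 := by
      have := first_integral_nonneg (Bf := Bf) hA hAA
      positivity
    have := ((((Real.hasDerivAt_log hA0.ne').add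
      (((h1.const_add (1 / Bf)).log hpos).const_mul 2)).add_const
      (Real.log (Bf / a ^ 2))).sub h2)
    rw [one_div A]
    exact this
  -- The derivative is at least `1 / A - I₂(A) = 1 / (A (1 + A f²))`, and `m` bounds `A f²`.
  refine ⟨1 / (1 + m), by positivity, ?_, fun A hAA => (hder A hAA).continuousAt.continuousWithinAt⟩
  have hder' : ∀ A ∈ Set.Ici Af, HasDerivAt (fun A => pairFun a Af Bf A - 1 / (1 + m) * Real.log A)
      (1 / A + 2 * (firstIntegrand Af Bf A / (1 / Bf + ∫ w in Af..A, firstIntegrand Af Bf w))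
        - secondIntegrand Af Bf A - 1 / (1 + m) * A⁻¹) A := fun A hAA =>
    (hder A hAA).sub ((Real.hasDerivAt_log (hA.trans_le hAA).ne').const_mul _)
  refine monotoneOn_of_hasDerivWithinAt_nonneg (convex_Ici Af)
    (fun A hAA => (hder' A hAA).continuousAt.continuousWithinAt)
    (fun A hAA => (hder' A (interior_subset hAA)).hasDerivWithinAt) fun A hAA => ?_
  replace hAA : A ∈ Set.Ici Af := interior_subset hAA
  have hA0 : 0 < A := hA.trans_le hAA
  have hf := f_pos Af Bf hA0
  have h1 : 0 ≤ firstIntegrand Af Bf A / (1 / Bf + ∫ w in Af..A, firstIntegrand Af Bf w) := by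
    have := first_integral_nonneg (Bf := Bf) hA hAA
    have : 0 ≤ firstIntegrand Af Bf A := by unfold firstIntegrand; positivity
    positivity
  have h2 : 1 / A - secondIntegrand Af Bf A = 1 / (1 + A * f Af Bf A ^ 2) * A⁻¹ := by
    unfold secondIntegrand; field_simp; ring
  have h3 : 1 / (1 + m) * A⁻¹ ≤ 1 / (1 + A * f Af Bf A ^ 2) * A⁻¹ := by
    gcongr
    exact mul_f_sq_le hA hAA
  linarith

lemma exists_unique_zero_pairFun {a Af Bf : ℝ} (ha : 0 < a) (hA : 0 < Af) (hB : 0 < Bf)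
    (h : Af / Bf ≤ a ^ 2) : ∃! A, Af ≤ A ∧ pairFun a Af Bf A = 0 := by
  obtain ⟨κ, hκ, hmono, hcont⟩ := pairFun_slope (a := a) hA hB
  have hstart : pairFun a Af Bf Af ≤ 0 := by
    have : pairFun a Af Bf Af = Real.log (Af / Bf / a ^ 2) := by
      unfold pairFun
      rw [intervalIntegral.integral_same, intervalIntegral.integral_same, add_zero, sub_zero,
        Real.log_div hB.ne' (by positivity),
        Real.log_div (div_pos hA hB).ne' (by positivity), Real.log_div hA.ne' hB.ne', one_div,
        Real.log_inv]
      ring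
    rw [this]
    exact Real.log_nonpos (by positivity) (div_le_one_of_le₀ h (by positivity))
  -- At this point the guaranteed increase `κ log (A' / Af)` cancels the initial value.
  set A' := Af * Real.exp (-pairFun a Af Bf Af / κ) with hA'
  have hle : Af ≤ A' := le_mul_of_one_le_right hA.le
    (Real.one_le_exp (div_nonneg (by linarith) hκ.le))
  have hend : 0 ≤ pairFun a Af Bf A' := by
    have h1 := hmono (Set.mem_Ici.2 le_rfl) (Set.mem_Ici.2 hle) hle
    have h2 : Real.log A' = Real.log Af + -pairFun a Af Bf Af / κ := by
      rw [hA', Real.log_mul hA.ne' (Real.exp_ne_zero _), Real.log_exp]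
    have h3 : κ * (-pairFun a Af Bf Af / κ) = -pairFun a Af Bf Af := by field_simp
    simp only [h2, mul_add, h3] at h1
    linarith
  obtain ⟨A, hAm, hA0⟩ := intermediate_value_Icc hle (hcont.mono Set.Icc_subset_Ici_self)
    ⟨hstart, hend⟩
  have hlt : ∀ x y, Af ≤ x → x < y → pairFun a Af Bf x < pairFun a Af Bf y := by
    intro x y hx hxy
    have h1 := hmono (Set.mem_Ici.2 hx) (Set.mem_Ici.2 (hx.trans hxy.le)) hxy.le
    have h2 := mul_lt_mul_of_pos_left (Real.log_lt_log (hA.trans_le hx) hxy) hκ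
    simp only at h1
    linarith
  refine ⟨A, ⟨hAm.1, hA0⟩, fun y ⟨hy, hy0⟩ => ?_⟩
  rcases lt_trichotomy y A with h1 | h1 | h1
  · have := hlt y A hy h1; linarith
  · exact h1
  · have := hlt A y hAm.1 h1; linarith

/-- The first condition can be solved for `ψ`; substituted into the second it leaves one equation in
`A`. -/
lemma isPair_iff {a Af Bf A ψ : ℝ} (ha : 0 < a) (hA : 0 < Af) (hB : 0 < Bf) :
    IsPair a Af Bf A ψ ↔ (Af ≤ A ∧ pairFun a Af Bf A = 0) ∧
      ψ = A / (a * (1 / Bf + ∫ w in Af..A, firstIntegrand Af Bf w)) := by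
  have key : ∀ u, 0 < A → 0 < u → Real.log (A ^ 3 * Bf / (a ^ 4 * (A / (a * u)) ^ 2)) =
      Real.log A + 2 * Real.log u + Real.log (Bf / a ^ 2) := by
    intro u hA0 hu
    have : A ^ 3 * Bf / (a ^ 4 * (A / (a * u)) ^ 2) = A * u ^ 2 * (Bf / a ^ 2) := by
      field_simp
    rw [this, Real.log_mul (by positivity) (by positivity), Real.log_mul (by positivity)
      (by positivity), Real.log_pow]
    push_cast; ring
  change (_ ∧ _ ∧ (∫ w in Af..A, firstIntegrand Af Bf w) = _ ∧
    (∫ w in Af..A, secondIntegrand Af Bf w) = _) ↔ _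
  unfold pairFun
  constructor
  · rintro ⟨h1, h2, h3, h4⟩
    have hA0 := hA.trans_le h1
    have hu : 1 / Bf + ∫ w in Af..A, firstIntegrand Af Bf w = A / (a * ψ) := by rw [h3]; ring
    have hψ : ψ = A / (a * (A / (a * ψ))) := by field_simp
    rw [hu]
    refine ⟨⟨h1, ?_⟩, hψ⟩
    rw [h4]
    nth_rewrite 2 [hψ]
    rw [key _ hA0 (by positivity)]
    ring
  · rintro ⟨⟨h1, h2⟩, h3⟩
    have hA0 := hA.trans_le h1
    have hI := first_integral_nonneg (Bf := Bf) hA h1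
    have hu : 0 < 1 / Bf + ∫ w in Af..A, firstIntegrand Af Bf w := by positivity
    refine ⟨h1, by rw [h3]; positivity, ?_, ?_⟩
    · rw [h3]; field_simp; ring
    · rw [h3, key _ hA0 hu]; linarith

theorem existsUnique_isPair {a Af Bf : ℝ} (ha : 0 < a) (hA : 0 < Af) (hB : 0 < Bf)
    (h : Af / Bf ≤ a ^ 2) : ∃! p : ℝ × ℝ, IsPair a Af Bf p.1 p.2 := by
  obtain ⟨A, hAA, huniq⟩ := exists_unique_zero_pairFun ha hA hB h
  refine ⟨(A, A / (a * (1 / Bf + ∫ w in Af..A, firstIntegrand Af Bf w))),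
    (isPair_iff ha hA hB).2 ⟨hAA, rfl⟩, fun p hp => ?_⟩
  have hp' := (isPair_iff ha hA hB).1 hp
  have := huniq _ hp'.1
  ext
  · exact this
  · rw [hp'.2, this]

end Pair

/-! ### Finite codes: rank-one signalling with a linear receiver. -/

section LinearCode

open Matrix

/-- Cauchy–Schwarz for the quadratic form `1 + D Dᵀ` combined with the matrix determinant lemma:
every linear receiver `h` gives a lower bound on the signal-to-noise ratio. -/
lemma one_add_snr_le_det_ratio {k : ℕ} (D : Matrix (Fin k) (Fin k) ℝ) (y h : Fin k → ℝ)
    (hh : h ≠ 0) :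
    1 + (h ⬝ᵥ y) ^ 2 / (h ⬝ᵥ h + (Dᵀ *ᵥ h) ⬝ᵥ (Dᵀ *ᵥ h)) ≤
      (vecMulVec y y + 1 + D * Dᵀ).det / (1 + D * Dᵀ).det := by
  set M := 1 + D * Dᵀ with hM
  have hMpd : M.PosDef := by
    have := posSemidef_self_mul_conjTranspose D
    rw [conjTranspose_eq_transpose_of_trivial] at this
    exact PosDef.one.add_posSemidef this
  have hdet : 0 < M.det := hMpd.det_pos
  have hunit : IsUnit M.det := hdet.ne'.isUnit
  have hform : ∀ u v : Fin k → ℝ, u ⬝ᵥ (M *ᵥ v) = u ⬝ᵥ v + (Dᵀ *ᵥ u) ⬝ᵥ (Dᵀ *ᵥ v) := by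
    intro u v
    rw [hM, add_mulVec, one_mulVec, dotProduct_add, ← mulVec_mulVec, dotProduct_mulVec,
      mulVec_transpose D u]
  set z := M⁻¹ *ᵥ y with hz
  have hMz : M *ᵥ z = y := by
    rw [hz, mulVec_mulVec, mul_nonsing_inv _ hunit, one_mulVec]
  have hratio : (vecMulVec y y + 1 + D * Dᵀ).det / M.det = 1 + z ⬝ᵥ (M *ᵥ z) := by
    have : vecMulVec y y + 1 + D * Dᵀ = M + replicateCol Unit y * replicateRow Unit y := by
      rw [hM, ← vecMulVec_eq Unit, add_assoc, add_comm]
    rw [this, det_add_replicateCol_mul_replicateRow hunit, mul_comm, mul_div_assoc,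
      div_self hdet.ne', mul_one, hMz, dotProduct_comm]
    simp [det_unique, hz, mul_apply, dotProduct, mulVec, replicateRow, replicateCol,
      Finset.sum_mul, Finset.mul_sum]
    rw [Finset.sum_comm]
    simp [mul_assoc]
  rw [hratio]
  have hpos : 0 < h ⬝ᵥ h + (Dᵀ *ᵥ h) ⬝ᵥ (Dᵀ *ᵥ h) := by
    have h1 : 0 < h ⬝ᵥ h := by simpa using dotProduct_star_self_pos_iff.2 hh
    have h2 : 0 ≤ (Dᵀ *ᵥ h) ⬝ᵥ (Dᵀ *ᵥ h) := Finset.sum_nonneg fun i _ => mul_self_nonneg _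
    linarith
  have hyh : h ⬝ᵥ y = h ⬝ᵥ z + (Dᵀ *ᵥ h) ⬝ᵥ (Dᵀ *ᵥ z) := by rw [← hform, hMz]
  -- The form `M` evaluated at `t h + z`; its discriminant is Cauchy–Schwarz.
  have hquad : ∀ t : ℝ, 0 ≤ (h ⬝ᵥ h + (Dᵀ *ᵥ h) ⬝ᵥ (Dᵀ *ᵥ h)) * (t * t) + (2 * (h ⬝ᵥ y)) * t
      + z ⬝ᵥ (M *ᵥ z) := by
    intro t
    have h1 : 0 ≤ (t • h + z) ⬝ᵥ (t • h + z) := Finset.sum_nonneg fun i _ => mul_self_nonneg _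
    have h2 : 0 ≤ (Dᵀ *ᵥ (t • h + z)) ⬝ᵥ (Dᵀ *ᵥ (t • h + z)) :=
      Finset.sum_nonneg fun i _ => mul_self_nonneg _
    rw [hform, hyh]
    simp only [mulVec_add, mulVec_smul, add_dotProduct, dotProduct_add, smul_dotProduct,
      dotProduct_smul, smul_eq_mul, dotProduct_comm z h,
      dotProduct_comm (Dᵀ *ᵥ z) (Dᵀ *ᵥ h)] at h1 h2
    linarith
  have := discrim_le_zero hquad
  unfold discrim at this
  rw [add_le_add_iff_left, div_le_iff₀ hpos]
  linarith

lemma trace_vecMulVec_code {k : ℕ} (a : ℝ) (D : Matrix (Fin k) (Fin k) ℝ) (x : Fin k → ℝ) :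
    (vecMulVec x x + a ^ 2 • (D * vecMulVec x x * Dᵀ) + D * Dᵀ).trace =
      x ⬝ᵥ x + (a ^ 2 * ((D *ᵥ x) ⬝ᵥ (D *ᵥ x)) + ∑ i, ∑ j, D i j ^ 2) := by
  have h1 : D * vecMulVec x x * Dᵀ = vecMulVec (D *ᵥ x) (D *ᵥ x) := by
    rw [mul_vecMulVec, vecMulVec_mul, vecMul_transpose]
  rw [h1, trace_add, trace_add, trace_smul, trace_vecMulVec, trace_vecMulVec, smul_eq_mul,
    add_assoc]
  congr 2
  simp [trace, mul_apply, sq]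

lemma rank_vecMulVec_self {k : ℕ} {x : Fin k → ℝ} (hx : x ≠ 0) :
    (vecMulVec x x).rank = 1 := by
  refine le_antisymm (rank_vecMulVec_le x x) (Nat.one_le_iff_ne_zero.2 fun h0 => hx ?_)
  have h1 : vecMulVec x x = 0 := by
    have := LinearMap.range_eq_bot.1 (Submodule.finrank_eq_zero.1 h0)
    ext i j
    simpa using congrFun (LinearMap.congr_fun this (Pi.single j 1)) i
  ext i
  have := congrFun (congrFun h1 i) i
  simpa [vecMulVec_apply] using this

/-- Energy-per-bit achieved by transmitting along `x`, relaying with `b⁻¹ D` and receiving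
with `h`. -/
lemma minEnergyRankOne_le {a b : ℝ} (hb : 0 < b) {k : ℕ} (D : Matrix (Fin k) (Fin k) ℝ)
    (hD : StrictlyLower D) (x h : Fin k → ℝ)
    (hN : h ⬝ᵥ x + a * (x ⬝ᵥ (Dᵀ *ᵥ h)) ≠ 0) :
    minEnergyRankOne a b ≤
      (((x ⬝ᵥ x + (a ^ 2 * ((D *ᵥ x) ⬝ᵥ (D *ᵥ x)) + ∑ i, ∑ j, D i j ^ 2) / b ^ 2) /
        (1 / 2 * Real.logb 2 (1 + (h ⬝ᵥ x + a * (x ⬝ᵥ (Dᵀ *ᵥ h))) ^ 2 /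
          (h ⬝ᵥ h + (Dᵀ *ᵥ h) ⬝ᵥ (Dᵀ *ᵥ h)))) : ℝ) : EReal) := by
  have hx : x ≠ 0 := by rintro rfl; simp at hN
  have hh : h ≠ 0 := by rintro rfl; simp at hN
  have hk : 0 < k := by
    rcases Nat.eq_zero_or_pos k with rfl | hk
    · exact absurd (Subsingleton.elim _ _) hx
    · exact hk
  have hdot : h ⬝ᵥ (x + a • (D *ᵥ x)) = h ⬝ᵥ x + a * (x ⬝ᵥ (Dᵀ *ᵥ h)) := by
    rw [dotProduct_add, dotProduct_smul, smul_eq_mul, dotProduct_mulVec, ← mulVec_transpose,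
      dotProduct_comm x]
  have hsnr := one_add_snr_le_det_ratio D (x + a • (D *ᵥ x)) h hh
  rw [hdot] at hsnr
  have hpos : 0 < h ⬝ᵥ h + (Dᵀ *ᵥ h) ⬝ᵥ (Dᵀ *ᵥ h) := by
    have h1 : 0 < h ⬝ᵥ h := by simpa using dotProduct_star_self_pos_iff.2 hh
    have h2 : 0 ≤ (Dᵀ *ᵥ h) ⬝ᵥ (Dᵀ *ᵥ h) := Finset.sum_nonneg fun i _ => mul_self_nonneg _
    linarith
  have hmem : minEnergyRankOne a b ≤
      ((linearEnergyPerBit a b (vecMulVec x x) (b⁻¹ • D) : ℝ) : EReal) :=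
    sInf_le ⟨k, hk, vecMulVec x x, b⁻¹ • D, by simpa using posSemidef_vecMulVec_self_star x,
      rank_vecMulVec_self hx, fun i j hij => by simp [hD i j hij], rfl⟩
  refine hmem.trans ?_
  · rw [EReal.coe_le_coe_iff]
    unfold linearEnergyPerBit
    rw [trace_vecMulVec_code]
    -- The scaling by `b⁻¹` removes `b` from the determinants and leaves it only as `1 / b²` in the
    -- relay energy.
    have e1 : (a * b) • (b⁻¹ • D) = a • D := by
      rw [smul_smul]; congr 1; field_simp
    have e2 : b ^ 2 • (b⁻¹ • D * (b⁻¹ • D)ᵀ) = D * Dᵀ := by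
      rw [transpose_smul, smul_mul_smul_comm, smul_smul]
      convert one_smul ℝ (D * Dᵀ) using 2
      field_simp
    have e3 : (a * b) • (b⁻¹ • D)ᵀ = a • Dᵀ := by
      rw [← transpose_smul, e1, transpose_smul]
    have e4 : (1 + a • D) * vecMulVec x x * (1 + a • Dᵀ) =
        vecMulVec (x + a • (D *ᵥ x)) (x + a • (D *ᵥ x)) := by
      rw [mul_vecMulVec, vecMulVec_mul, add_mulVec, one_mulVec, vecMul_add, vecMul_one,
        vecMul_smul, vecMul_transpose, smul_mulVec]
    rw [e1, e2, e3, e4]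
    have e5 : x ⬝ᵥ x + (a ^ 2 * ((b⁻¹ • D) *ᵥ x ⬝ᵥ (b⁻¹ • D) *ᵥ x)
          + ∑ i, ∑ j, (b⁻¹ • D) i j ^ 2) =
        x ⬝ᵥ x + (a ^ 2 * ((D *ᵥ x) ⬝ᵥ (D *ᵥ x)) + ∑ i, ∑ j, D i j ^ 2) / b ^ 2 := by
      simp only [smul_mulVec, smul_dotProduct, dotProduct_smul, Matrix.smul_apply,
        smul_eq_mul, mul_pow,
        ← Finset.mul_sum]
      field_simp
    rw [e5]
    have hlog : 0 < Real.logb 2 (1 + (h ⬝ᵥ x + a * (x ⬝ᵥ (Dᵀ *ᵥ h))) ^ 2 /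
          (h ⬝ᵥ h + (Dᵀ *ᵥ h) ⬝ᵥ (Dᵀ *ᵥ h))) := by
      refine Real.logb_pos (by norm_num) ?_
      have : 0 < (h ⬝ᵥ x + a * (x ⬝ᵥ (Dᵀ *ᵥ h))) ^ 2 := by positivity
      have := div_pos this hpos
      linarith
    have hnum : 0 ≤ x ⬝ᵥ x + (a ^ 2 * ((D *ᵥ x) ⬝ᵥ (D *ᵥ x)) + ∑ i, ∑ j, D i j ^ 2) / b ^ 2 := by
      have h1 : 0 ≤ x ⬝ᵥ x := Finset.sum_nonneg fun i _ => mul_self_nonneg _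
      have h2 : 0 ≤ (D *ᵥ x) ⬝ᵥ (D *ᵥ x) := Finset.sum_nonneg fun i _ => mul_self_nonneg _
      have h3 : 0 ≤ ∑ i, ∑ j, D i j ^ 2 :=
        Finset.sum_nonneg fun i _ => Finset.sum_nonneg fun j _ => sq_nonneg _
      positivity
    gcongr
    · norm_num

end LinearCode

/-! ### Convergence of sums over a grid to integrals. -/

section Grid

open Matrix Filter Topology MeasureTheory

/-- The `i`-th node of the grid that divides `[p, q]` into `n + 1` cells, counted from `q` down. -/
noncomputable def node (p q : ℝ) (n i : ℕ) : ℝ := q - (q - p) / (n + 1) * i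

/-- The index of the grid cell that contains `v`. -/
noncomputable def cell (p q : ℝ) (n : ℕ) (v : ℝ) : ℕ := ⌊(q - v) * ((n + 1) / (q - p))⌋₊

lemma node_mem_Icc {p q : ℝ} (hpq : p < q) {n i : ℕ} (hi : i ≤ n) :
    node p q n i ∈ Set.Icc p q := by
  have h1 : (0 : ℝ) < q - p := sub_pos.2 hpq
  have h2 : (q - p) / (n + 1) * i ≤ q - p := by
    rw [div_mul_eq_mul_div, div_le_iff₀ (by positivity)]
    have : (i : ℝ) ≤ n + 1 := by exact_mod_cast hi.trans n.le_succ
    gcongr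
  have h3 : 0 ≤ (q - p) / (n + 1) * i := by positivity
  unfold node
  constructor <;> linarith

lemma cell_le {p q v : ℝ} {n : ℕ} (hv : v ∈ Set.Ioc p q) : cell p q n v ≤ n := by
  have h1 : 0 < q - p := sub_pos.2 (hv.1.trans_le hv.2)
  have h2 : 0 ≤ q - v := sub_nonneg.2 hv.2
  rw [← Nat.lt_succ_iff, cell, Nat.floor_lt (by positivity), ← mul_div_assoc, div_lt_iff₀ h1]
  push_cast
  rw [mul_comm]
  have := hv.1
  gcongr

lemma tendsto_node_cell {p q v : ℝ} (hv : v ∈ Set.Ioo p q) :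
    Tendsto (fun n => node p q n (cell p q n v)) atTop (𝓝 v) := by
  have h1 : 0 < q - p := sub_pos.2 (hv.1.trans hv.2)
  have h2 : 0 ≤ q - v := (sub_pos.2 hv.2).le
  have hlim : Tendsto (fun n : ℕ => (q - p) * (1 / ((n : ℝ) + 1))) atTop (𝓝 0) := by
    simpa using tendsto_one_div_add_atTop_nhds_zero_nat.const_mul (q - p)
  have hdist : ∀ n : ℕ, |node p q n (cell p q n v) - v| ≤ (q - p) * (1 / ((n : ℝ) + 1)) := by
    intro n
    have h3 : (0 : ℝ) ≤ (q - v) * ((n + 1) / (q - p)) := by positivity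
    have h4 := Nat.floor_le h3
    have h5 := Nat.lt_floor_add_one ((q - v) * ((n + 1) / (q - p)))
    have e : node p q n (cell p q n v) - v =
        (q - p) * (1 / ((n : ℝ) + 1)) * ((q - v) * ((n + 1) / (q - p)) - cell p q n v) := by
      unfold node; field_simp; ring
    have h6 : 0 ≤ (q - p) * (1 / ((n : ℝ) + 1)) := by positivity
    rw [e, abs_mul, abs_of_nonneg h6]
    refine mul_le_of_le_one_right h6 (abs_le.2 ⟨?_, ?_⟩) <;> unfold cell <;> linarith
  have := squeeze_zero_norm (f := fun n => node p q n (cell p q n v) - v) hdist hlim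
  simpa using this.add_const v

lemma lt_of_node_lt {p q : ℝ} (hpq : p < q) {n i j : ℕ} (h : node p q n i < node p q n j) :
    j < i := by
  by_contra! hij
  have h1 : (0 : ℝ) < q - p := sub_pos.2 hpq
  have h2 : (q - p) / (n + 1) * i ≤ (q - p) / (n + 1) * j := by gcongr
  unfold node at h
  linarith

lemma eventually_cell_lt {p q u v : ℝ} (hu : u ∈ Set.Ioo p q) (hv : v ∈ Set.Ioo p q)
    (huv : v < u) : ∀ᶠ n in atTop, cell p q n u < cell p q n v :=
  ((tendsto_node_cell hv).eventually_lt (tendsto_node_cell hu) huv).mono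
    fun _ hn => lt_of_node_lt (hu.1.trans hu.2) hn

lemma integral_comp_floor (n : ℕ) (g : ℕ → ℝ) :
    ∫ t in (0 : ℝ)..(n : ℝ), g ⌊t⌋₊ = ∑ i ∈ Finset.range n, g i := by
  have hcell : ∀ i : ℕ, Set.EqOn (fun _ => g i) (fun t : ℝ => g ⌊t⌋₊)
      (Set.uIoo (i : ℝ) ((i + 1 : ℕ) : ℝ)) := by
    intro i t ht
    rw [Set.uIoo_of_le (by simp)] at ht
    have : ⌊t⌋₊ = i := (Nat.floor_eq_iff (i.cast_nonneg.trans ht.1.le)).2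
      ⟨ht.1.le, by exact_mod_cast ht.2⟩
    simp [this]
  have h := intervalIntegral.sum_integral_adjacent_intervals (f := fun t : ℝ => g ⌊t⌋₊)
    (μ := volume) (a := fun i : ℕ => (i : ℝ)) (n := n) fun i _ =>
      (intervalIntegrable_const (c := g i)).congr_uIoo (hcell i)
  rw [Nat.cast_zero] at h
  rw [← h]
  refine Finset.sum_congr rfl fun i _ => ?_
  rw [← intervalIntegral.integral_congr_uIoo (hcell i)]
  simp

/-- A grid sum is the integral of a step function, so its limit follows from dominated convergence
even for weights that depend on `n`. -/
lemma integral_comp_cell {p q : ℝ} (hpq : p < q) (n : ℕ) (g : ℕ → ℝ) :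
    ∫ v in p..q, g (cell p q n v) = (q - p) / (n + 1) * ∑ i ∈ Finset.range (n + 1), g i := by
  have h1 : 0 < q - p := sub_pos.2 hpq
  have hc : ((n : ℝ) + 1) / (q - p) ≠ 0 := by positivity
  unfold cell
  rw [intervalIntegral.integral_comp_sub_left
      (fun t => g ⌊t * (((n : ℝ) + 1) / (q - p))⌋₊) q,
    intervalIntegral.integral_comp_mul_right (fun t => g ⌊t⌋₊) hc, sub_self, zero_mul,
    mul_div_cancel₀ _ h1.ne', ← integral_comp_floor, inv_div, smul_eq_mul]
  push_cast
  rfl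

lemma tendsto_grid_sum {p q : ℝ} (hpq : p < q) {w : ℕ → ℕ → ℝ} {W : ℝ → ℝ} {C : ℝ}
    (hC : ∀ n, ∀ i ≤ n, |w n i| ≤ C)
    (hlim : ∀ᵐ v : ℝ, v ∈ Set.Ioo p q →
      Tendsto (fun n => w n (cell p q n v)) atTop (𝓝 (W v))) :
    Tendsto (fun n : ℕ => (q - p) / (n + 1) * ∑ i ∈ Finset.range (n + 1), w n i) atTop
      (𝓝 (∫ v in p..q, W v)) := by
  simp_rw [← integral_comp_cell hpq]
  refine intervalIntegral.tendsto_integral_filter_of_dominated_convergence (fun _ => C)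
    (Eventually.of_forall fun n => ?_) (Eventually.of_forall fun n => ae_of_all _ fun v hv => ?_)
    intervalIntegrable_const ?_
  · have : Measurable (cell p q n) := by unfold cell; fun_prop
    exact ((measurable_from_nat (f := w n)).comp this).aestronglyMeasurable
  · rw [Set.uIoc_of_le hpq.le] at hv
    exact hC n _ (cell_le hv)
  · have hq : ∀ᵐ v : ℝ, v ≠ q := by simp [ae_iff]
    filter_upwards [hlim, hq] with v hv hvq hmem
    rw [Set.uIoc_of_le hpq.le] at hmem
    exact hv ⟨hmem.1, lt_of_le_of_ne hmem.2 hvq⟩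

lemma abs_grid_sum_le {p q : ℝ} (hpq : p < q) {n : ℕ} {w : ℕ → ℝ} {C : ℝ}
    (hC : ∀ i ≤ n, |w i| ≤ C) :
    |(q - p) / (n + 1) * ∑ i ∈ Finset.range (n + 1), w i| ≤ (q - p) * C := by
  have h1 : 0 < q - p := sub_pos.2 hpq
  have h2 : |∑ i ∈ Finset.range (n + 1), w i| ≤ (n + 1) * C := by
    refine (Finset.abs_sum_le_sum_abs _ _).trans ?_
    have := Finset.sum_le_card_nsmul (Finset.range (n + 1)) (fun i => |w i|) C fun i hi =>
      hC i (Nat.lt_succ_iff.1 (Finset.mem_range.1 hi))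
    simpa using this
  rw [abs_mul, abs_of_nonneg (by positivity)]
  calc (q - p) / (n + 1) * |∑ i ∈ Finset.range (n + 1), w i|
      ≤ (q - p) / (n + 1) * ((n + 1) * C) := by gcongr
    _ = _ := by field_simp

variable {p q : ℝ} {F : ℝ → ℝ → ℝ}

/-- A continuous kernel on a compact square is bounded. -/
lemma exists_kernel_bound
    (hF : ContinuousOn (fun z : ℝ × ℝ => F z.1 z.2) (Set.Icc p q ×ˢ Set.Icc p q)) :
    ∃ C, 0 ≤ C ∧ ∀ v ∈ Set.Icc p q, ∀ u ∈ Set.Icc p q, |F v u| ≤ C := by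
  obtain ⟨C, hC⟩ := (isCompact_Icc.prod isCompact_Icc).exists_bound_of_continuousOn hF
  exact ⟨max C 0, le_max_right _ _, fun v hv u hu => (hC (v, u) ⟨hv, hu⟩).trans (le_max_left _ _)⟩

lemma tendsto_kernel_node (hpq : p < q)
    (hF : ContinuousOn (fun z : ℝ × ℝ => F z.1 z.2) (Set.Icc p q ×ˢ Set.Icc p q))
    {u v : ℝ} (hv : v ∈ Set.Ioo p q) (hu : u ∈ Set.Ioo p q) :
    Tendsto (fun n => F (node p q n (cell p q n v)) (node p q n (cell p q n u))) atTop
      (𝓝 (F v u)) := by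
  have h := (hF (v, u) ⟨Set.Ioo_subset_Icc_self hv, Set.Ioo_subset_Icc_self hu⟩).tendsto
  refine h.comp (tendsto_nhdsWithin_iff.2
    ⟨(tendsto_node_cell hv).prodMk_nhds (tendsto_node_cell hu), Eventually.of_forall fun n => ?_⟩)
  exact ⟨node_mem_Icc hpq (cell_le (Set.Ioo_subset_Ioc_self hv)),
    node_mem_Icc hpq (cell_le (Set.Ioo_subset_Ioc_self hu))⟩

/-- The grid sum over the nodes strictly before node `i`, that is over larger arguments. -/
noncomputable def sumBefore (p q : ℝ) (F : ℝ → ℝ → ℝ) (n i : ℕ) : ℝ :=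
  (q - p) / (n + 1) * ∑ j ∈ Finset.range (n + 1),
    if j < i then F (node p q n i) (node p q n j) else 0

/-- The grid sum over the nodes strictly after node `i`, that is over smaller arguments. -/
noncomputable def sumAfter (p q : ℝ) (F : ℝ → ℝ → ℝ) (n i : ℕ) : ℝ :=
  (q - p) / (n + 1) * ∑ j ∈ Finset.range (n + 1),
    if i < j then F (node p q n i) (node p q n j) else 0

lemma abs_sumBefore_le (hpq : p < q) {C : ℝ} (hC0 : 0 ≤ C)
    (hC : ∀ v ∈ Set.Icc p q, ∀ u ∈ Set.Icc p q, |F v u| ≤ C) {n i : ℕ} (hi : i ≤ n) :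
    |sumBefore p q F n i| ≤ (q - p) * C :=
  abs_grid_sum_le hpq fun j hj => by
    split_ifs
    · exact hC _ (node_mem_Icc hpq hi) _ (node_mem_Icc hpq hj)
    · simpa

lemma abs_sumAfter_le (hpq : p < q) {C : ℝ} (hC0 : 0 ≤ C)
    (hC : ∀ v ∈ Set.Icc p q, ∀ u ∈ Set.Icc p q, |F v u| ≤ C) {n i : ℕ} (hi : i ≤ n) :
    |sumAfter p q F n i| ≤ (q - p) * C :=
  abs_grid_sum_le hpq fun j hj => by
    split_ifs
    · exact hC _ (node_mem_Icc hpq hi) _ (node_mem_Icc hpq hj)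
    · simpa

lemma integral_ite_gt {v : ℝ} (hv : v ∈ Set.Icc p q) (g : ℝ → ℝ) :
    ∫ u in p..q, (if v < u then g u else 0) = ∫ u in v..q, g u := by
  rw [intervalIntegral.integral_of_le (hv.1.trans hv.2), intervalIntegral.integral_of_le hv.2,
    ← integral_indicator measurableSet_Ioc, ← integral_indicator measurableSet_Ioc]
  congr 1
  ext u
  by_cases h1 : v < u <;> by_cases h2 : u ≤ q <;> by_cases h3 : p < u <;>
    simp [Set.indicator, h1, h2, h3]
  exact absurd (hv.1.trans_lt h1) h3

lemma integral_ite_lt {v : ℝ} (hv : v ∈ Set.Icc p q) (g : ℝ → ℝ) :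
    ∫ u in p..q, (if u < v then g u else 0) = ∫ u in p..v, g u := by
  rw [intervalIntegral.integral_of_le (hv.1.trans hv.2), intervalIntegral.integral_of_le hv.1,
    integral_Ioc_eq_integral_Ioo, integral_Ioc_eq_integral_Ioo,
    ← integral_indicator measurableSet_Ioo, ← integral_indicator measurableSet_Ioo]
  congr 1
  ext u
  by_cases h1 : u < v <;> by_cases h2 : u < q <;> by_cases h3 : p < u <;>
    simp [Set.indicator, h1, h2, h3]
  exact absurd (h1.trans_le hv.2) h2

/-- The cutoff `j < i` becomes `v < u`, since indices run against the order of the interval. It is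
only unsettled at `u = v`, a null set. -/
lemma tendsto_sumBefore (hpq : p < q)
    (hF : ContinuousOn (fun z : ℝ × ℝ => F z.1 z.2) (Set.Icc p q ×ˢ Set.Icc p q))
    {v : ℝ} (hv : v ∈ Set.Ioo p q) :
    Tendsto (fun n => sumBefore p q F n (cell p q n v)) atTop (𝓝 (∫ u in v..q, F v u)) := by
  obtain ⟨C, hC0, hC⟩ := exists_kernel_bound hF
  rw [← integral_ite_gt (Set.Ioo_subset_Icc_self hv)]
  have hvn := fun n => node_mem_Icc hpq (cell_le (n := n) (Set.Ioo_subset_Ioc_self hv))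
  refine tendsto_grid_sum (C := C) hpq (w := fun n j => if j < cell p q n v then
    F (node p q n (cell p q n v)) (node p q n j) else 0) (fun n j hj => ?_) ?_
  · split_ifs
    · exact hC _ (hvn n) _ (node_mem_Icc hpq hj)
    · simpa
  · have hne : ∀ᵐ u : ℝ, u ≠ v := by simp [ae_iff]
    filter_upwards [hne] with u huv hu
    rcases lt_or_gt_of_ne huv with h | h
    · rw [if_neg h.not_gt]
      exact tendsto_const_nhds.congr' ((eventually_cell_lt hv hu h).mono
        fun n hn => (if_neg hn.not_gt).symm)
    · rw [if_pos h]
      exact (tendsto_kernel_node hpq hF hv hu).congr' ((eventually_cell_lt hu hv h).mono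
        fun n hn => (if_pos hn).symm)

lemma tendsto_sumAfter (hpq : p < q)
    (hF : ContinuousOn (fun z : ℝ × ℝ => F z.1 z.2) (Set.Icc p q ×ˢ Set.Icc p q))
    {v : ℝ} (hv : v ∈ Set.Ioo p q) :
    Tendsto (fun n => sumAfter p q F n (cell p q n v)) atTop (𝓝 (∫ u in p..v, F v u)) := by
  obtain ⟨C, hC0, hC⟩ := exists_kernel_bound hF
  rw [← integral_ite_lt (Set.Ioo_subset_Icc_self hv)]
  have hvn := fun n => node_mem_Icc hpq (cell_le (n := n) (Set.Ioo_subset_Ioc_self hv))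
  refine tendsto_grid_sum (C := C) hpq (w := fun n j => if cell p q n v < j then
    F (node p q n (cell p q n v)) (node p q n j) else 0) (fun n j hj => ?_) ?_
  · split_ifs
    · exact hC _ (hvn n) _ (node_mem_Icc hpq hj)
    · simpa
  · have hne : ∀ᵐ u : ℝ, u ≠ v := by simp [ae_iff]
    filter_upwards [hne] with u huv hu
    rcases lt_or_gt_of_ne huv with h | h
    · rw [if_pos h]
      exact (tendsto_kernel_node hpq hF hv hu).congr' ((eventually_cell_lt hv hu h).mono
        fun n hn => (if_pos hn).symm)
    · rw [if_neg h.not_gt]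
      exact tendsto_const_nhds.congr' ((eventually_cell_lt hu hv h).mono
        fun n hn => (if_neg hn.not_gt).symm)

end Grid

/-! ### From a continuous-time code to matrices and vectors. -/

section Sampling

open Matrix Filter Topology MeasureTheory

/-- The relaying matrix sampled from a kernel. -/
noncomputable def gridMatrix (p q : ℝ) (K : ℝ → ℝ → ℝ) (n : ℕ) :
    Matrix (Fin (n + 1)) (Fin (n + 1)) ℝ :=
  of fun i j => if j < i then (q - p) / (n + 1) * K (node p q n i) (node p q n j) else 0

/-- The vector sampled from a function. -/
noncomputable def gridVector (p q : ℝ) (X : ℝ → ℝ) (n : ℕ) (i : Fin (n + 1)) : ℝ :=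
  √((q - p) / (n + 1)) * X (node p q n i)

lemma gridMatrix_strictlyLower (p q : ℝ) (K : ℝ → ℝ → ℝ) (n : ℕ) :
    StrictlyLower (gridMatrix p q K n) := fun i j hij => by
  simp [gridMatrix, hij.not_gt]

lemma mesh_nonneg {p q : ℝ} (hpq : p < q) (n : ℕ) : 0 ≤ (q - p) / ((n : ℝ) + 1) := by
  have : 0 < q - p := sub_pos.2 hpq
  positivity

lemma gridVector_dotProduct {p q : ℝ} (hpq : p < q) (X : ℝ → ℝ) (n : ℕ) (w : ℕ → ℝ) :
    gridVector p q X n ⬝ᵥ (fun i => √((q - p) / (n + 1)) * w i) =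
      (q - p) / (n + 1) * ∑ i ∈ Finset.range (n + 1), X (node p q n i) * w i := by
  rw [← Fin.sum_univ_eq_sum_range (fun i => X (node p q n i) * w i), Finset.mul_sum]
  refine Finset.sum_congr rfl fun i _ => ?_
  have := Real.mul_self_sqrt (mesh_nonneg hpq n)
  unfold gridVector
  linear_combination (X (node p q n i) * w i) * this

lemma sqrt_mesh_dotProduct {p q : ℝ} (hpq : p < q) (n : ℕ) (w : ℕ → ℝ) :
    (fun i : Fin (n + 1) => √((q - p) / (n + 1)) * w i) ⬝ᵥ
        (fun i => √((q - p) / (n + 1)) * w i) =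
      (q - p) / (n + 1) * ∑ i ∈ Finset.range (n + 1), w i ^ 2 := by
  rw [← Fin.sum_univ_eq_sum_range (fun i => w i ^ 2), Finset.mul_sum]
  refine Finset.sum_congr rfl fun i _ => ?_
  have := Real.mul_self_sqrt (mesh_nonneg hpq n)
  linear_combination (w i ^ 2) * this

/-- With weight `√mesh` on vectors and `mesh` on matrices, the product is again a vector of weight
`√mesh`, and dot products are Riemann sums. -/
lemma gridMatrix_mulVec (p q : ℝ) (K : ℝ → ℝ → ℝ) (X : ℝ → ℝ) (n : ℕ) :
    gridMatrix p q K n *ᵥ gridVector p q X n =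
    fun i : Fin (n + 1) => √((q - p) / (n + 1)) * sumBefore p q (fun v u => K v u * X u) n i := by
  ext i
  change ∑ j, gridMatrix p q K n i j * gridVector p q X n j = _
  unfold sumBefore
  rw [← Fin.sum_univ_eq_sum_range (fun j => if j < (i : ℕ) then
    K (node p q n i) (node p q n j) * X (node p q n j) else 0), Finset.mul_sum, Finset.mul_sum]
  refine Finset.sum_congr rfl fun j _ => ?_
  by_cases h : j < i
  · simp [gridMatrix, gridVector, h]; ring
  · simp [gridMatrix, gridVector, h]

lemma gridMatrix_transpose_mulVec (p q : ℝ) (K : ℝ → ℝ → ℝ) (Y : ℝ → ℝ) (n : ℕ) :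
    (gridMatrix p q K n)ᵀ *ᵥ gridVector p q Y n =
    fun i : Fin (n + 1) => √((q - p) / (n + 1)) * sumAfter p q (fun v u => K u v * Y u) n i := by
  ext i
  change ∑ j, gridMatrix p q K n j i * gridVector p q Y n j = _
  unfold sumAfter
  rw [← Fin.sum_univ_eq_sum_range (fun j => if (i : ℕ) < j then
    K (node p q n j) (node p q n i) * Y (node p q n j) else 0), Finset.mul_sum, Finset.mul_sum]
  refine Finset.sum_congr rfl fun j _ => ?_
  by_cases h : i < j
  · simp [gridMatrix, gridVector, h]; ring
  · simp [gridMatrix, gridVector, h]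

lemma gridMatrix_sum_sq (p q : ℝ) (K : ℝ → ℝ → ℝ) (n : ℕ) :
    ∑ i, ∑ j, gridMatrix p q K n i j ^ 2 =
    (q - p) / (n + 1) * ∑ i ∈ Finset.range (n + 1), sumBefore p q (fun v u => K v u ^ 2) n i := by
  rw [← Fin.sum_univ_eq_sum_range (fun i => sumBefore p q (fun v u => K v u ^ 2) n i),
    Finset.mul_sum]
  refine Finset.sum_congr rfl fun i _ => ?_
  unfold sumBefore
  rw [← Fin.sum_univ_eq_sum_range (fun j => if j < (i : ℕ) then
    K (node p q n i) (node p q n j) ^ 2 else 0), Finset.mul_sum, Finset.mul_sum]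
  refine Finset.sum_congr rfl fun j _ => ?_
  by_cases h : j < i
  · simp [gridMatrix, h]; ring
  · simp [gridMatrix, h]

lemma tendsto_node_cell_comp {p q : ℝ} (hpq : p < q) {W : ℝ → ℝ}
    (hW : ContinuousOn W (Set.Icc p q)) {v : ℝ} (hv : v ∈ Set.Ioo p q) :
    Tendsto (fun n => W (node p q n (cell p q n v))) atTop (𝓝 (W v)) :=
  (hW v (Set.Ioo_subset_Icc_self hv)).tendsto.comp (tendsto_nhdsWithin_iff.2
    ⟨tendsto_node_cell hv, Eventually.of_forall fun _ => node_mem_Icc hpq (cell_le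
      (Set.Ioo_subset_Ioc_self hv))⟩)

lemma tendsto_grid_sum_of_continuousOn {p q : ℝ} (hpq : p < q) {W : ℝ → ℝ}
    (hW : ContinuousOn W (Set.Icc p q)) :
    Tendsto (fun n : ℕ => (q - p) / (n + 1) * ∑ i ∈ Finset.range (n + 1), W (node p q n i)) atTop
      (𝓝 (∫ v in p..q, W v)) := by
  obtain ⟨C, hC⟩ := isCompact_Icc.exists_bound_of_continuousOn hW
  refine tendsto_grid_sum hpq (C := C) (w := fun n i => W (node p q n i))
    (fun _ _ hi => hC _ (node_mem_Icc hpq hi))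
    (ae_of_all _ fun v hv => tendsto_node_cell_comp hpq hW hv)

/-- Sampling a continuous-time code (signal `X`, relaying kernel `K`, receiver `Y`, time running
from `q` down to `p`) ever more finely bounds the minimum energy-per-bit. -/
theorem minEnergyRankOne_le_of_kernel {a b p q : ℝ} (hb : 0 < b) (hpq : p < q)
    {K : ℝ → ℝ → ℝ} {X Y : ℝ → ℝ} (hX : ContinuousOn X (Set.Icc p q))
    (hY : ContinuousOn Y (Set.Icc p q))
    (hK : ContinuousOn (fun z : ℝ × ℝ => K z.1 z.2) (Set.Icc p q ×ˢ Set.Icc p q))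
    {P E N V : ℝ} (hP : ∫ v in p..q, X v ^ 2 = P)
    (hE : ∫ v in p..q, (a ^ 2 * (∫ u in v..q, K v u * X u) ^ 2 + ∫ u in v..q, K v u ^ 2) = E)
    (hN : (∫ v in p..q, Y v * X v) + a * ∫ v in p..q, X v * ∫ u in p..v, K u v * Y u = N)
    (hV : (∫ v in p..q, Y v ^ 2) + ∫ v in p..q, (∫ u in p..v, K u v * Y u) ^ 2 = V)
    (hN0 : N ≠ 0) (hV0 : 0 < V) :
    minEnergyRankOne a b ≤
      (((P + E / b ^ 2) / (1 / 2 * Real.logb 2 (1 + N ^ 2 / V)) : ℝ) : EReal) := by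
  have hX2 : ContinuousOn (fun z : ℝ × ℝ => X z.2) (Set.Icc p q ×ˢ Set.Icc p q) :=
    hX.comp continuousOn_snd fun z hz => hz.2
  have hY2 : ContinuousOn (fun z : ℝ × ℝ => Y z.2) (Set.Icc p q ×ˢ Set.Icc p q) :=
    hY.comp continuousOn_snd fun z hz => hz.2
  have hKswap : ContinuousOn (fun z : ℝ × ℝ => K z.2 z.1) (Set.Icc p q ×ˢ Set.Icc p q) :=
    hK.comp continuous_swap.continuousOn fun z hz => ⟨hz.2, hz.1⟩
  have hKX : ContinuousOn (fun z : ℝ × ℝ => (fun v u => K v u * X u) z.1 z.2)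
    (Set.Icc p q ×ˢ Set.Icc p q) := hK.mul hX2
  have hKK : ContinuousOn (fun z : ℝ × ℝ => (fun v u => K v u ^ 2) z.1 z.2)
    (Set.Icc p q ×ˢ Set.Icc p q) := hK.pow 2
  have hKY : ContinuousOn (fun z : ℝ × ℝ => (fun v u => K u v * Y u) z.1 z.2)
    (Set.Icc p q ×ˢ Set.Icc p q) := hKswap.mul hY2
  obtain ⟨C₁, hC₁0, hC₁⟩ := exists_kernel_bound (F := fun v u => K v u * X u) hKX
  obtain ⟨C₂, hC₂0, hC₂⟩ := exists_kernel_bound (F := fun v u => K v u ^ 2) hKK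
  obtain ⟨C₃, hC₃0, hC₃⟩ := exists_kernel_bound (F := fun v u => K u v * Y u) hKY
  obtain ⟨C₄, hC₄⟩ := isCompact_Icc.exists_bound_of_continuousOn hX
  have hqp : 0 < q - p := sub_pos.2 hpq
  have limP : Tendsto (fun n => gridVector p q X n ⬝ᵥ gridVector p q X n) atTop (𝓝 P) := by
    rw [← hP]
    refine (tendsto_grid_sum_of_continuousOn hpq (hX.pow 2)).congr fun n => ?_
    exact (sqrt_mesh_dotProduct hpq n fun i => X (node p q n i)).symm
  have limE : Tendsto (fun n => a ^ 2 *
      ((gridMatrix p q K n *ᵥ gridVector p q X n) ⬝ᵥ (gridMatrix p q K n *ᵥ gridVector p q X n)) +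
      ∑ i, ∑ j, gridMatrix p q K n i j ^ 2)
      atTop (𝓝 E) := by
    rw [← hE]
    refine (tendsto_grid_sum hpq (C := a ^ 2 * ((q - p) * C₁) ^ 2 + (q - p) * C₂)
      (w := fun n i => a ^ 2 * sumBefore p q (fun v u => K v u * X u) n i ^ 2 +
        sumBefore p q (fun v u => K v u ^ 2) n i) (fun n i hi => ?_)
      (ae_of_all _ fun v hv => ?_)).congr fun n => ?_
    · refine (abs_add_le _ _).trans ?_
      rw [abs_mul, abs_of_nonneg (sq_nonneg a), abs_pow]
      have h1 := abs_sumBefore_le hpq hC₁0 hC₁ hi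
      have h2 := abs_sumBefore_le hpq hC₂0 hC₂ hi
      gcongr
    · exact (((tendsto_sumBefore (F := fun v u => K v u * X u) hpq hKX hv).pow 2).const_mul _).add
        (tendsto_sumBefore (F := fun v u => K v u ^ 2) hpq hKK hv)
    · rw [gridMatrix_sum_sq, gridMatrix_mulVec, sqrt_mesh_dotProduct hpq n,
        Finset.sum_add_distrib, ← Finset.mul_sum]
      ring
  have limN : Tendsto (fun n => gridVector p q Y n ⬝ᵥ gridVector p q X n +
      a * (gridVector p q X n ⬝ᵥ ((gridMatrix p q K n)ᵀ *ᵥ gridVector p q Y n))) atTop (𝓝 N) := by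
    rw [← hN]
    refine Tendsto.add ?_ (Tendsto.const_mul _ ?_)
    · refine (tendsto_grid_sum_of_continuousOn hpq (hY.mul hX)).congr fun n => ?_
      exact (gridVector_dotProduct hpq Y n fun i => X (node p q n i)).symm
    · refine (tendsto_grid_sum hpq (C := C₄ * ((q - p) * C₃))
        (w := fun n i => X (node p q n i) * sumAfter p q (fun v u => K u v * Y u) n i)
        (fun n i hi => ?_) (ae_of_all _ fun v hv => ?_)).congr fun n => ?_
      · rw [abs_mul]
        have h1 := abs_sumAfter_le hpq hC₃0 hC₃ hi
        have h2 := hC₄ _ (node_mem_Icc hpq hi)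
        rw [Real.norm_eq_abs] at h2
        have h3 := (abs_nonneg _).trans h2
        gcongr
      · exact (tendsto_node_cell_comp hpq hX hv).mul
          (tendsto_sumAfter (F := fun v u => K u v * Y u) hpq hKY hv)
      · rw [gridMatrix_transpose_mulVec, gridVector_dotProduct hpq]
  have limV : Tendsto (fun n => gridVector p q Y n ⬝ᵥ gridVector p q Y n +
      ((gridMatrix p q K n)ᵀ *ᵥ gridVector p q Y n) ⬝ᵥ ((gridMatrix p q K n)ᵀ *ᵥ gridVector p q Y n)) atTop
      (𝓝 V) := by
    rw [← hV]
    refine Tendsto.add ?_ ?_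
    · refine (tendsto_grid_sum_of_continuousOn hpq (hY.pow 2)).congr fun n => ?_
      exact (sqrt_mesh_dotProduct hpq n fun i => Y (node p q n i)).symm
    · refine (tendsto_grid_sum hpq (C := ((q - p) * C₃) ^ 2)
        (w := fun n i => sumAfter p q (fun v u => K u v * Y u) n i ^ 2)
        (fun n i hi => ?_) (ae_of_all _ fun v hv => ?_)).congr fun n => ?_
      · rw [abs_pow]
        have h1 := abs_sumAfter_le hpq hC₃0 hC₃ hi
        gcongr
      · exact (tendsto_sumAfter (F := fun v u => K u v * Y u) hpq hKY hv).pow 2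
      · rw [gridMatrix_transpose_mulVec, sqrt_mesh_dotProduct hpq n]
  have hsnr : 0 < N ^ 2 / V := by positivity
  have hlog : 1 / 2 * Real.logb 2 (1 + N ^ 2 / V) ≠ 0 := by
    have := Real.logb_pos (b := 2) (by norm_num) (show 1 < 1 + N ^ 2 / V by linarith)
    positivity
  have hlim := (limP.add (limE.div_const (b ^ 2))).div
    (((((limN.pow 2).div limV hV0.ne').const_add 1).logb (b := 2) (by positivity)).const_mul
      (1 / 2)) hlog
  -- The infimum is below each sampled code with nonzero receiver gain, hence below the limit.
  refine ge_of_tendsto ((continuous_coe_real_ereal.tendsto _).comp hlim) ?_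
  filter_upwards [limN.eventually_ne hN0] with n hn
  exact minEnergyRankOne_le hb (gridMatrix p q K n) (gridMatrix_strictlyLower p q K n)
    (gridVector p q X n) (gridVector p q Y n) hn

end Sampling

/-! ### The explicit code and its antiderivatives. -/

section ContinuousCode

open Set MeasureTheory

lemma integral_eq_sub_of_hasDerivAt_Ioi {G g : ℝ → ℝ} (hG : ∀ w, 0 < w → HasDerivAt G (g w) w)
    (hg : ContinuousOn g (Ioi 0)) {x y : ℝ} (hx : 0 < x) (hy : 0 < y) :
    ∫ w in x..y, g w = G y - G x :=
  intervalIntegral.integral_eq_sub_of_hasDerivAt (fun w hw => hG w (uIcc_subset_Ioi hx hy hw))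
    (intervalIntegrable_of_continuousOn_Ioi hg hx hy)

/-- The tail of the first integral, up to the scaling by `ψ` the relay's linear estimation gain. -/
noncomputable def firstTail (Af Bf A w : ℝ) : ℝ := ∫ u in w..A, firstIntegrand Af Bf u

/-- One plus the signal-to-noise ratio accumulated at the relay. -/
noncomputable def relayGain (Af Bf A w : ℝ) : ℝ := Real.exp (∫ u in w..A, secondIntegrand Af Bf u)

/-- The transmitted signal. -/
noncomputable def signal (a Af Bf A w : ℝ) : ℝ :=
  √(relayGain Af Bf A w * secondIntegrand Af Bf w) / a

/-- The ratio between the receiver and the transmitted signal. -/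
noncomputable def receiverRatio (Af Bf A w : ℝ) : ℝ := A / (w * relayGain Af Bf A w)

/-- The ratio between the multiplier of the relay's rows and the transmitted signal. -/
noncomputable def relayRatio (Af Bf A ψ w : ℝ) : ℝ := (1 / f Af Bf w + firstTail Af Bf A w) / ψ

/-- The relaying kernel. -/
noncomputable def relayKernel (a Af Bf A ψ w v : ℝ) : ℝ :=
  receiverRatio Af Bf A w * signal a Af Bf A w *
    (signal a Af Bf A v * (relayRatio Af Bf A ψ v - firstTail Af Bf A w / ψ))

/-- The receiver. -/
noncomputable def receiver (a Af Bf A w : ℝ) : ℝ :=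
  receiverRatio Af Bf A w * signal a Af Bf A w

/-- The antiderivative of the squared receiver. -/
noncomputable def receiverEnergy (a Af Bf A w : ℝ) : ℝ :=
  A ^ 2 * f Af Bf w / (a ^ 2 * relayGain Af Bf A w)

lemma relayGain_pos (Af Bf A w : ℝ) : 0 < relayGain Af Bf A w := Real.exp_pos _

@[simp] lemma relayGain_self (Af Bf A : ℝ) : relayGain Af Bf A A = 1 := by simp [relayGain]

@[simp] lemma firstTail_self (Af Bf A : ℝ) : firstTail Af Bf A A = 0 := by simp [firstTail]

lemma secondIntegrand_pos (Af Bf : ℝ) {w : ℝ} (hw : 0 < w) : 0 < secondIntegrand Af Bf w := by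
  have := f_pos Af Bf hw
  unfold secondIntegrand; positivity

lemma signal_sq (a Af Bf A : ℝ) {w : ℝ} (hw : 0 < w) :
    signal a Af Bf A w ^ 2 = relayGain Af Bf A w * secondIntegrand Af Bf w / a ^ 2 := by
  have := secondIntegrand_pos Af Bf hw
  have := relayGain_pos Af Bf A w
  rw [signal, div_pow, Real.sq_sqrt (by positivity)]

lemma hasDerivAt_firstTail (Af Bf : ℝ) {A w : ℝ} (hA : 0 < A) (hw : 0 < w) :
    HasDerivAt (firstTail Af Bf A) (-firstIntegrand Af Bf w) w :=
  hasDerivAt_integral_left (continuousOn_firstIntegrand Af Bf) hA hw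

lemma hasDerivAt_relayGain (Af Bf : ℝ) {A w : ℝ} (hA : 0 < A) (hw : 0 < w) :
    HasDerivAt (relayGain Af Bf A) (-(relayGain Af Bf A w * secondIntegrand Af Bf w)) w := by
  rw [← mul_neg]
  exact (hasDerivAt_integral_left (continuousOn_secondIntegrand Af Bf) hA hw).exp

lemma hasDerivAt_inv_f (Af Bf : ℝ) {w : ℝ} (hw : 0 < w) :
    HasDerivAt (fun v => 1 / f Af Bf v)
      (-(1 / w ^ 2 - f Af Bf w) / (1 + w * f Af Bf w ^ 2)) w := by
  have hf := f_pos Af Bf hw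
  simp only [one_div (f Af Bf _)]
  refine ((hasDerivAt_f Af Bf hw).inv hf.ne').congr_deriv ?_
  field_simp

section continuity

variable (a Af Bf ψ : ℝ) {A : ℝ}

lemma continuousOn_firstTail (hA : 0 < A) : ContinuousOn (firstTail Af Bf A) (Ioi 0) :=
  fun _ hw => (hasDerivAt_firstTail Af Bf hA hw).continuousAt.continuousWithinAt

lemma continuousOn_relayGain (hA : 0 < A) : ContinuousOn (relayGain Af Bf A) (Ioi 0) :=
  fun _ hw => (hasDerivAt_relayGain Af Bf hA hw).continuousAt.continuousWithinAt

lemma continuousOn_signal (hA : 0 < A) : ContinuousOn (signal a Af Bf A) (Ioi 0) :=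
  ((continuousOn_relayGain Af Bf hA).mul (continuousOn_secondIntegrand Af Bf)).sqrt.div_const a

lemma continuousOn_receiverRatio (hA : 0 < A) : ContinuousOn (receiverRatio Af Bf A) (Ioi 0) :=
  continuousOn_const.div (continuousOn_id.mul (continuousOn_relayGain Af Bf hA))
    fun w (hw : 0 < w) => (mul_pos hw (relayGain_pos Af Bf A w)).ne'

lemma continuousOn_relayRatio (hA : 0 < A) : ContinuousOn (relayRatio Af Bf A ψ) (Ioi 0) :=
  ((continuousOn_const.div (continuousOn_f Af Bf) fun _ hw => (f_pos Af Bf hw).ne').add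
    (continuousOn_firstTail Af Bf hA)).div_const ψ

lemma continuousOn_receiver (hA : 0 < A) : ContinuousOn (receiver a Af Bf A) (Ioi 0) :=
  (continuousOn_receiverRatio Af Bf hA).mul (continuousOn_signal a Af Bf hA)

lemma continuousOn_relayKernel (hA : 0 < A) :
    ContinuousOn (fun z : ℝ × ℝ => relayKernel a Af Bf A ψ z.1 z.2) (Ioi 0 ×ˢ Ioi 0) := by
  have h1 : MapsTo Prod.fst (Ioi (0 : ℝ) ×ˢ Ioi (0 : ℝ)) (Ioi 0) := fun _ hz => hz.1
  have h2 : MapsTo Prod.snd (Ioi (0 : ℝ) ×ˢ Ioi (0 : ℝ)) (Ioi 0) := fun _ hz => hz.2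
  have hfst := continuousOn_fst (s := Ioi (0 : ℝ) ×ˢ Ioi (0 : ℝ))
  have hsnd := continuousOn_snd (s := Ioi (0 : ℝ) ×ˢ Ioi (0 : ℝ))
  exact ((continuousOn_receiver a Af Bf hA).comp hfst h1).mul
    (((continuousOn_signal a Af Bf hA).comp hsnd h2).mul
      (((continuousOn_relayRatio Af Bf ψ hA).comp hsnd h2).sub
        (((continuousOn_firstTail Af Bf hA).comp hfst h1).div_const ψ)))

end continuity

section derivatives

variable {a ψ A w : ℝ} (Af Bf : ℝ)

lemma hasDerivAt_gain_signal (hA : 0 < A) (hw : 0 < w) :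
    HasDerivAt (fun v => -relayGain Af Bf A v / a ^ 2) (signal a Af Bf A w ^ 2) w := by
  refine ((hasDerivAt_relayGain Af Bf hA hw).neg.div_const (a ^ 2)).congr_deriv ?_
  rw [signal_sq a Af Bf A hw]
  ring

lemma hasDerivAt_gain_relayRatio (ha : 0 < a) (hψ : 0 < ψ) (hA : 0 < A) (hw : 0 < w) :
    HasDerivAt (fun v => -(firstTail Af Bf A v * relayGain Af Bf A v) / (a ^ 2 * ψ))
      (relayRatio Af Bf A ψ w * signal a Af Bf A w ^ 2) w := by
  have hf := f_pos Af Bf hw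
  refine (((hasDerivAt_firstTail Af Bf hA hw).mul
    (hasDerivAt_relayGain Af Bf hA hw)).neg.div_const (a ^ 2 * ψ)).congr_deriv ?_
  rw [signal_sq a Af Bf A hw]
  unfold relayRatio firstIntegrand secondIntegrand
  field_simp
  ring

/-- The term `v S` completes the square: `2 T I₁ + T² I₂ + (1 - w I₂) = I₂ (T + 1 / f)²`. -/
lemma hasDerivAt_gain_relayRatio_sq (ha : 0 < a) (hψ : 0 < ψ) (hA : 0 < A) (hw : 0 < w) :
    HasDerivAt (fun v => -(firstTail Af Bf A v ^ 2 * relayGain Af Bf A v -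
        v * relayGain Af Bf A v) / (a ^ 2 * ψ ^ 2))
      (relayRatio Af Bf A ψ w ^ 2 * signal a Af Bf A w ^ 2) w := by
  have hf := f_pos Af Bf hw
  refine ((((((hasDerivAt_firstTail Af Bf hA hw).pow 2).mul (hasDerivAt_relayGain Af Bf hA hw)).sub
    ((hasDerivAt_id w).mul (hasDerivAt_relayGain Af Bf hA hw))).neg).div_const
      (a ^ 2 * ψ ^ 2)).congr_deriv ?_
  rw [signal_sq a Af Bf A hw]
  unfold relayRatio firstIntegrand secondIntegrand
  simp only [id, Pi.pow_apply]
  field_simp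
  ring

lemma receiver_sq (hw : 0 < w) : receiver a Af Bf A w ^ 2 =
    A ^ 2 * secondIntegrand Af Bf w / (a ^ 2 * w ^ 2 * relayGain Af Bf A w) := by
  have := relayGain_pos Af Bf A w
  rw [receiver, mul_pow, signal_sq a Af Bf A hw, receiverRatio]
  field_simp

/-- By the ODE, `(f / S)' = I₂ / (w² S)`. -/
lemma hasDerivAt_receiverEnergy (ha : 0 < a) (hA : 0 < A) (hw : 0 < w) :
    HasDerivAt (receiverEnergy a Af Bf A) (receiver a Af Bf A w ^ 2) w := by
  have hf := f_pos Af Bf hw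
  have hS := relayGain_pos Af Bf A w
  refine (((hasDerivAt_f Af Bf hw).const_mul (A ^ 2)).div
    ((hasDerivAt_relayGain Af Bf hA hw).const_mul (a ^ 2)) (by positivity)).congr_deriv ?_
  rw [receiver_sq Af Bf hw]
  unfold secondIntegrand
  field_simp
  ring

/-- The derivative of `relayRatio` times `receiverEnergy` is `-receiver² / (f ψ)`, which cancels the
`1 / f` part of `relayRatio`. -/
lemma hasDerivAt_relayRatio_mul_receiverEnergy (ha : 0 < a) (hψ : 0 < ψ) (hA : 0 < A)
    (hw : 0 < w) :
    HasDerivAt (fun v => relayRatio Af Bf A ψ v * receiverEnergy a Af Bf A v)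
      (firstTail Af Bf A w / ψ * receiver a Af Bf A w ^ 2) w := by
  have hf := f_pos Af Bf hw
  have hS := relayGain_pos Af Bf A w
  refine ((((hasDerivAt_inv_f Af Bf hw).add (hasDerivAt_firstTail Af Bf hA hw)).div_const ψ).mul
    (hasDerivAt_receiverEnergy Af Bf ha hA hw)).congr_deriv ?_
  rw [receiver_sq Af Bf hw]
  unfold receiverEnergy firstIntegrand secondIntegrand
  simp only [Pi.add_apply]
  field_simp
  ring

/-- By the ODE, `(w f + T)' = I₂ / w`. -/
lemma hasDerivAt_receiver_mul_signal (ha : 0 < a) (hA : 0 < A) (hw : 0 < w) :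
    HasDerivAt (fun v => A / a ^ 2 * (v * f Af Bf v + firstTail Af Bf A v))
      (receiver a Af Bf A w * signal a Af Bf A w) w := by
  have hf := f_pos Af Bf hw
  have hS := relayGain_pos Af Bf A w
  refine ((((hasDerivAt_id w).mul (hasDerivAt_f Af Bf hw)).add
    (hasDerivAt_firstTail Af Bf hA hw)).const_mul (A / a ^ 2)).congr_deriv ?_
  rw [receiver, mul_assoc, ← sq, signal_sq a Af Bf A hw]
  unfold receiverRatio firstIntegrand secondIntegrand
  simp only [id]
  field_simp
  ring

lemma hasDerivAt_relayEnergy (ha : 0 < a) (hψ : 0 < ψ) (hA : 0 < A) (hw : 0 < w) :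
    HasDerivAt (fun v => A ^ 2 / (a ^ 4 * ψ ^ 2) *
        (A * (f Af Bf v / relayGain Af Bf A v) - (v * f Af Bf v + firstTail Af Bf A v)))
      (receiver a Af Bf A w ^ 2 * ((A - w * relayGain Af Bf A w) / (a ^ 2 * ψ ^ 2))) w := by
  have hf := f_pos Af Bf hw
  have hS := relayGain_pos Af Bf A w
  refine (((((hasDerivAt_f Af Bf hw).div (hasDerivAt_relayGain Af Bf hA hw) hS.ne').const_mul
    A).sub (((hasDerivAt_id w).mul (hasDerivAt_f Af Bf hw)).add
    (hasDerivAt_firstTail Af Bf hA hw))).const_mul (A ^ 2 / (a ^ 4 * ψ ^ 2))).congr_deriv ?_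
  rw [receiver_sq Af Bf hw]
  unfold firstIntegrand secondIntegrand
  simp only [id]
  field_simp
  ring

end derivatives

end ContinuousCode

/-! ### Energies of the code and the final bound. -/

section Bound

open Set MeasureTheory

variable {a b Af Bf A ψ : ℝ}

lemma integral_relayKernel_mul_signal (ha : 0 < a) (hψ : 0 < ψ) (hA : 0 < A) {w : ℝ}
    (hw : 0 < w) :
    ∫ u in w..A, relayKernel a Af Bf A ψ w u * signal a Af Bf A u =
      receiver a Af Bf A w * (firstTail Af Bf A w / ψ / a ^ 2) := by
  rw [integral_eq_sub_of_hasDerivAt_Ioi (G := fun v => receiver a Af Bf A w *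
    (-(firstTail Af Bf A v * relayGain Af Bf A v) / (a ^ 2 * ψ) -
      firstTail Af Bf A w / ψ * (-relayGain Af Bf A v / a ^ 2))) ?_ ?_ hw hA]
  · simp only [relayGain_self, firstTail_self]
    field_simp
    ring
  · intro v hv
    refine (((hasDerivAt_gain_relayRatio Af Bf ha hψ hA hv).sub
      ((hasDerivAt_gain_signal Af Bf hA hv).const_mul (firstTail Af Bf A w / ψ))).const_mul
      (receiver a Af Bf A w)).congr_deriv ?_
    unfold relayKernel receiver
    ring
  · exact ((continuousOn_relayKernel a Af Bf ψ hA).comp (f := fun u => (w, u)) (by fun_prop)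
      fun u hu => ⟨hw, hu⟩).mul (continuousOn_signal a Af Bf hA)

/-- The negative term is exactly what the forwarded signal power contributes to the relay energy, so
the sum of the two no longer contains `T`. -/
lemma integral_relayKernel_sq (ha : 0 < a) (hψ : 0 < ψ) (hA : 0 < A) {w : ℝ} (hw : 0 < w) :
    ∫ u in w..A, relayKernel a Af Bf A ψ w u ^ 2 =
      receiver a Af Bf A w ^ 2 * ((A - w * relayGain Af Bf A w) / (a ^ 2 * ψ ^ 2)
        - (firstTail Af Bf A w / ψ) ^ 2 / a ^ 2) := by
  rw [integral_eq_sub_of_hasDerivAt_Ioi (G := fun v => receiver a Af Bf A w ^ 2 *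
    (-(firstTail Af Bf A v ^ 2 * relayGain Af Bf A v - v * relayGain Af Bf A v) /
        (a ^ 2 * ψ ^ 2) -
      2 * (firstTail Af Bf A w / ψ) *
        (-(firstTail Af Bf A v * relayGain Af Bf A v) / (a ^ 2 * ψ)) +
      (firstTail Af Bf A w / ψ) ^ 2 * (-relayGain Af Bf A v / a ^ 2))) ?_ ?_ hw hA]
  · simp only [relayGain_self, firstTail_self]
    field_simp
    ring
  · intro v hv
    refine ((((hasDerivAt_gain_relayRatio_sq Af Bf ha hψ hA hv).sub
      ((hasDerivAt_gain_relayRatio Af Bf ha hψ hA hv).const_mul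
        (2 * (firstTail Af Bf A w / ψ)))).add
      ((hasDerivAt_gain_signal Af Bf hA hv).const_mul
        ((firstTail Af Bf A w / ψ) ^ 2))).const_mul (receiver a Af Bf A w ^ 2)).congr_deriv ?_
    unfold relayKernel receiver
    ring
  · exact ((continuousOn_relayKernel a Af Bf ψ hA).comp (f := fun u => (w, u)) (by fun_prop)
      fun u hu => ⟨hw, hu⟩).pow 2

lemma integral_relayKernel_mul_receiver (ha : 0 < a) (hψ : 0 < ψ) (hA : 0 < A) (hAf : 0 < Af)
    {v : ℝ} (hv : 0 < v) :
    ∫ u in Af..v, relayKernel a Af Bf A ψ u v * receiver a Af Bf A u =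
      signal a Af Bf A v * ((relayRatio Af Bf A ψ Af - relayRatio Af Bf A ψ v) *
        receiverEnergy a Af Bf A Af) := by
  rw [integral_eq_sub_of_hasDerivAt_Ioi (G := fun u => signal a Af Bf A v *
    (relayRatio Af Bf A ψ v * receiverEnergy a Af Bf A u -
      relayRatio Af Bf A ψ u * receiverEnergy a Af Bf A u)) ?_ ?_ hAf hv]
  · ring
  · intro u hu
    refine ((((hasDerivAt_receiverEnergy Af Bf ha hA hu).const_mul _).sub
      (hasDerivAt_relayRatio_mul_receiverEnergy Af Bf ha hψ hA hu)).const_mul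
        (signal a Af Bf A v)).congr_deriv ?_
    unfold relayKernel receiver
    ring
  · exact ((continuousOn_relayKernel a Af Bf ψ hA).comp (f := fun u => (u, v)) (by fun_prop)
      fun u hu => ⟨hu, hv⟩).mul (continuousOn_receiver a Af Bf hA)

theorem minEnergyRankOne_le_energyBound (ha : 0 < a) (hb : 0 < b) (hAf : 0 < Af) (hBf : 0 < Bf)
    (hlt : Af / Bf < a ^ 2) : minEnergyRankOne a b ≤ ((energyBound a b Af Bf : ℝ) : EReal) := by
  have hpair : IsPair a Af Bf (pair a Af Bf).1 (pair a Af Bf).2 := by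
    obtain ⟨p, hp, -⟩ := existsUnique_isPair ha hAf hBf hlt.le
    exact Classical.epsilon_spec (p := fun p : ℝ × ℝ => IsPair a Af Bf p.1 p.2) ⟨p, hp⟩
  unfold energyBound
  dsimp only
  generalize (pair a Af Bf).1 = A at hpair ⊢
  generalize (pair a Af Bf).2 = ψ at hpair ⊢
  obtain ⟨hle, hψ, hI, hS⟩ := hpair
  have hA : 0 < A := hAf.trans_le hle
  have hf0 : f Af Bf Af = Bf := f_left hAf hBf
  have hI' : firstTail Af Bf A Af = A / (a * ψ) - 1 / Bf := hI
  have hS' : relayGain Af Bf A Af = A ^ 3 * Bf / (a ^ 4 * ψ ^ 2) := by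
    change Real.exp (∫ w in Af..A, f Af Bf w ^ 2 / (1 + w * f Af Bf w ^ 2)) = _
    rw [hS, Real.exp_log (by positivity)]
  -- For `A = Af` both integrals vanish and the conditions force `Af = a² Bf`, against strictness.
  have hAlt : Af < A := by
    refine lt_of_le_of_ne hle fun h => ?_
    subst h
    have h1 : Af / (a * ψ) = 1 / Bf := by simpa [sub_eq_zero, eq_comm] using hI'
    have h2 : Af ^ 3 * Bf / (a ^ 4 * ψ ^ 2) = 1 := by rw [← hS', relayGain_self]
    have h3 : Af ^ 3 * Bf / (a ^ 4 * ψ ^ 2) = (Af / (a * ψ)) ^ 2 * (Af * Bf / a ^ 2) := by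
      field_simp
    rw [h3, h1] at h2
    field_simp at h2
    rw [div_lt_iff₀ hBf] at hlt
    linarith
  have hsub : Icc Af A ⊆ Ioi 0 := fun w hw => hAf.trans_le hw.1
  -- Both pair conditions meet here: the constant in the adjoint kernel applied to the receiver
  -- becomes `a`.
  have hrelay : relayRatio Af Bf A ψ Af * receiverEnergy a Af Bf A Af = a := by
    unfold relayRatio receiverEnergy
    rw [hI', hS', hf0]
    field_simp
    ring
  set μ := receiverEnergy a Af Bf A Af with hμ
  have hμ' : μ = a ^ 2 * ψ ^ 2 / A := by
    rw [hμ, receiverEnergy, hS', hf0]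
    field_simp
  have hg : ∀ v ∈ Ioi (0 : ℝ), ∫ u in Af..v, relayKernel a Af Bf A ψ u v * receiver a Af Bf A u =
      signal a Af Bf A v * (a - relayRatio Af Bf A ψ v * μ) := fun v hv => by
    rw [integral_relayKernel_mul_receiver ha hψ hA hAf hv, sub_mul, hrelay]
  have hmem : ∀ w ∈ uIcc Af A, 0 < w := fun w hw => uIcc_subset_Ioi hAf hA hw
  have hP : ∫ v in Af..A, signal a Af Bf A v ^ 2 = Q₁ a Bf A ψ := by
    rw [integral_eq_sub_of_hasDerivAt_Ioi (fun v hv => hasDerivAt_gain_signal Af Bf hA hv)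
      ((continuousOn_signal a Af Bf hA).pow 2) hAf hA, relayGain_self, hS', Q₁]
    field_simp
    ring
  have hE : ∫ v in Af..A, (a ^ 2 * (∫ u in v..A, relayKernel a Af Bf A ψ v u *
      signal a Af Bf A u) ^ 2 + ∫ u in v..A, relayKernel a Af Bf A ψ v u ^ 2) =
      b ^ 2 * Q₂ a b Af Bf A ψ := by
    have hcongr : EqOn (fun v => a ^ 2 * (∫ u in v..A, relayKernel a Af Bf A ψ v u *
        signal a Af Bf A u) ^ 2 + ∫ u in v..A, relayKernel a Af Bf A ψ v u ^ 2)
        (fun v => receiver a Af Bf A v ^ 2 *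
          ((A - v * relayGain Af Bf A v) / (a ^ 2 * ψ ^ 2))) (uIcc Af A) := fun v hv => by
      dsimp only
      rw [integral_relayKernel_mul_signal ha hψ hA (hmem v hv),
        integral_relayKernel_sq ha hψ hA (hmem v hv)]
      field_simp
      ring
    rw [intervalIntegral.integral_congr hcongr, integral_eq_sub_of_hasDerivAt_Ioi
      (fun v hv => hasDerivAt_relayEnergy Af Bf ha hψ hA hv) ?_ hAf hA]
    · rw [relayGain_self, firstTail_self, hS', hI', hf0, Q₂]
      field_simp
      ring
    · exact ((continuousOn_receiver a Af Bf hA).pow 2).mul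
        ((continuousOn_const.sub (continuousOn_id.mul
          (continuousOn_relayGain Af Bf hA))).div_const _)
  have hN : (∫ v in Af..A, receiver a Af Bf A v * signal a Af Bf A v) +
      a * ∫ v in Af..A, signal a Af Bf A v *
        ∫ u in Af..v, relayKernel a Af Bf A ψ u v * receiver a Af Bf A u =
      A / a ^ 2 * (1 / Bf + A * f Af Bf A - Af * Bf) - 1 := by
    have hcongr : EqOn (fun v => signal a Af Bf A v *
        ∫ u in Af..v, relayKernel a Af Bf A ψ u v * receiver a Af Bf A u)
        (fun v => signal a Af Bf A v * (signal a Af Bf A v * (a - relayRatio Af Bf A ψ v * μ)))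
        (uIcc Af A) := fun v hv => by
      dsimp only
      rw [hg v (hmem v hv)]
    rw [intervalIntegral.integral_congr hcongr, integral_eq_sub_of_hasDerivAt_Ioi
      (fun v hv => hasDerivAt_receiver_mul_signal Af Bf ha hA hv)
      ((continuousOn_receiver a Af Bf hA).mul (continuousOn_signal a Af Bf hA)) hAf hA,
      integral_eq_sub_of_hasDerivAt_Ioi (G := fun v => a * (-relayGain Af Bf A v / a ^ 2) -
        μ * (-(firstTail Af Bf A v * relayGain Af Bf A v) / (a ^ 2 * ψ))) ?_ ?_
        hAf hA]
    · simp only [relayGain_self, firstTail_self]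
      rw [hS', hI', hf0, hμ']
      field_simp
      ring
    · intro v hv
      refine (((hasDerivAt_gain_signal Af Bf hA hv).const_mul a).sub
        ((hasDerivAt_gain_relayRatio Af Bf ha hψ hA hv).const_mul μ)).congr_deriv ?_
      ring
    · exact (continuousOn_signal a Af Bf hA).mul ((continuousOn_signal a Af Bf hA).mul
        (continuousOn_const.sub ((continuousOn_relayRatio Af Bf ψ hA).mul continuousOn_const)))
  have hcongrV : EqOn (fun v =>
      (∫ u in Af..v, relayKernel a Af Bf A ψ u v * receiver a Af Bf A u) ^ 2)
      (fun v => (signal a Af Bf A v * (a - relayRatio Af Bf A ψ v * μ)) ^ 2)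
      (uIcc Af A) := fun v hv => by
    dsimp only
    rw [hg v (hmem v hv)]
  have hV : (∫ v in Af..A, receiver a Af Bf A v ^ 2) +
      ∫ v in Af..A, (∫ u in Af..v, relayKernel a Af Bf A ψ u v * receiver a Af Bf A u) ^ 2 =
      A / a ^ 2 * (1 / Bf + A * f Af Bf A - Af * Bf) - 1 := by
    rw [intervalIntegral.integral_congr hcongrV, integral_eq_sub_of_hasDerivAt_Ioi
      (fun v hv => hasDerivAt_receiverEnergy Af Bf ha hA hv)
      ((continuousOn_receiver a Af Bf hA).pow 2) hAf hA,
      integral_eq_sub_of_hasDerivAt_Ioi (G := fun v => a ^ 2 * (-relayGain Af Bf A v / a ^ 2) -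
        2 * a * μ * (-(firstTail Af Bf A v * relayGain Af Bf A v) / (a ^ 2 * ψ)) +
        μ ^ 2 * (-(firstTail Af Bf A v ^ 2 * relayGain Af Bf A v - v * relayGain Af Bf A v) /
          (a ^ 2 * ψ ^ 2))) ?_ ?_ hAf hA]
    · simp only [relayGain_self, firstTail_self]
      rw [← hμ, hS', hI', hμ', receiverEnergy, relayGain_self]
      field_simp
      ring
    · intro v hv
      refine ((((hasDerivAt_gain_signal Af Bf hA hv).const_mul (a ^ 2)).sub
        ((hasDerivAt_gain_relayRatio Af Bf ha hψ hA hv).const_mul (2 * a * μ))).add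
        ((hasDerivAt_gain_relayRatio_sq Af Bf ha hψ hA hv).const_mul (μ ^ 2))).congr_deriv ?_
      ring
    · exact ((continuousOn_signal a Af Bf hA).mul (continuousOn_const.sub
        ((continuousOn_relayRatio Af Bf ψ hA).mul continuousOn_const))).pow 2
  have hVpos : 0 < A / a ^ 2 * (1 / Bf + A * f Af Bf A - Af * Bf) - 1 := by
    rw [← hV]
    refine add_pos_of_pos_of_nonneg ?_
      (intervalIntegral.integral_nonneg hle fun v _ => sq_nonneg _)
    refine intervalIntegral.intervalIntegral_pos_of_pos_on
      (intervalIntegrable_of_continuousOn_Ioi ((continuousOn_receiver a Af Bf hA).pow 2) hAf hA)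
      (fun v hv => ?_) hAlt
    have hv0 : 0 < v := hAf.trans hv.1
    have := secondIntegrand_pos Af Bf hv0
    have := relayGain_pos Af Bf A v
    rw [receiver_sq Af Bf hv0]
    positivity
  have hK : ContinuousOn (fun z : ℝ × ℝ => relayKernel a Af Bf A ψ z.1 z.2)
      (Icc Af A ×ˢ Icc Af A) :=
    (continuousOn_relayKernel a Af Bf ψ hA).mono (prod_mono hsub hsub)
  have hmain := minEnergyRankOne_le_of_kernel (a := a) hb hAlt
    ((continuousOn_signal a Af Bf hA).mono hsub) ((continuousOn_receiver a Af Bf hA).mono hsub)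
    hK hP hE hN hV hVpos.ne' hVpos
  -- Since `N = V`, the ratio `1 + N² / V` collapses to `1 + V`.
  rw [mul_div_cancel_left₀ _ (pow_ne_zero 2 hb.ne'), sq (_ - 1), mul_self_div_self,
    add_sub_cancel] at hmain
  exact hmain

end Bound

end GaussianRelay

theorem theorem1 (a b : ℝ) (ha : 0 < a) (hb : 0 < b) :
    (∀ Af Bf : ℝ, 0 < Af → 0 < Bf → Af / Bf ≤ a ^ 2 →
      ∃! p : ℝ × ℝ, GaussianRelay.IsPair a Af Bf p.1 p.2) ∧
    GaussianRelay.minEnergyRankOne a b ≤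
      sInf {E : EReal | ∃ Af Bf : ℝ, 0 < Af ∧ 0 < Bf ∧ Af / Bf < a ^ 2 ∧
        E = ((GaussianRelay.energyBound a b Af Bf : ℝ) : EReal)} := by
  refine ⟨fun Af Bf hA hB h => GaussianRelay.existsUnique_isPair ha hA hB h, le_sInf ?_⟩
  rintro E ⟨Af, Bf, hA, hB, h, rfl⟩
  exact GaussianRelay.minEnergyRankOne_le_energyBound ha hb hA hB h
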